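/- A \emph{timed automaton} (TA) $\mathcal T=(Q,\iota,C,\Delta,\Sigma,\mathrm{Acc})$ has a finite set $Q$ of states with initial state $\iota$, a finite set $C$ of clocks, an alphabet $\Sigma$, a finite set $\Delta$ of transitions $(s,g,a,X,s')$, where $s,s'\in Q$, $a\in\Sigma$, $X\subseteq C$ is the set of clocks to reset, and the guard $g$ is a Boolean combination (possibly $\mathrm{true}$) of constraints $x-y\triangleleft n$ with $x\in C$, $y\in C\cup\{0\}$, $n\in\mathbb N$, $\triangleleft\in\{<,\le\}$, and an acceptance condition $\mathrm{Acc}\subseteq\Delta^\omega$. For every state $s$, valuation $\nu\in\mathbb R_{\ge0}^C$ and letter $a$, some transition $(s,g,a,X,s')\in\Delta$ satisfies $\nu\models g$. The condition is \emph{safety} (\emph{reachability}) if, for some $F\subseteq Q$, a run is accepting iff all states (some state) it visits lie in $F$. A timed word is an infinite sequence of letters with non-decreasing time stamps in $\mathbb R_{\ge 0}$; the automaton, started in $\iota$ with all clocks $0$, reads it by alternating delays and transitions, and $L(\mathcal T)$ is the set of timed words that have an accepting run. $\mathcal T$ is \emph{deterministic} if any two distinct transitions from the same state on the same letter have mutually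 exclusive guards, and \emph{history-deterministic} if there is a resolver, i.e. a function that maps the finite run so far, the next delay and the next letter to a transition on that letter, such that for every $w\in L(\mathcal T)$ the transitions it chooses successively on $w$ form an accepting run on $w$. \textbf{Theorem.} Every history-deterministic timed automaton $\mathcal T=(Q,\iota,C,\Delta,\Sigma,\mathrm{Acc})$ with safety or reachability acceptance is equivalent to a deterministic timed automaton $\mathcal T'$ (that is, $L(\mathcal T')=L(\mathcal T)$) with the same states, initial state, clocks, alphabet and safety or reachability condition. Moreover $\mathcal T'$ can be chosen so that each of its transitions has the form $(s,g\wedge z,a,X,s')$ for some $(s,g,a,X,s')\in\Delta$ and some guard $z$. This holds under each of the usual conventions on timed words: zero delays may be allowed everywhere, only before the first letter (pairwise distinct time stamps), or nowhere, and independently of this, words of finite duration (Zeno words) may be allowed or excluded; the same convention is used for history-determinism and for both languages. -/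

import Mathlib

open scoped NNReal

namespace TimedAut

/-! ### Timed words -/

/-- An infinite sequence of letters paired with time stamps. -/
abbrev TimedSeq (A : Type*) := ℕ → A × ℝ≥0

/-- The `i`-th delay: `d₀ = t₀` and `t_{i+1} = t_i + d_{i+1}` (for non-decreasing time stamps). -/
noncomputable def delay {A : Type*} (w : TimedSeq A) : ℕ → ℝ≥0
  | 0 => (w 0).2
  | i + 1 => (w (i + 1)).2 - (w i).2

/-- How time has to progress between letters: `weak` allows zero delays, `distinct` asks for
pairwise distinct time stamps (so only the first delay may be zero), and `strong` forbids all
zero delays. -/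
inductive Progression
  | weak
  | distinct
  | strong

/-- A convention on which infinite timed words are considered. If `divergent` holds,
words of finite duration (Zeno words) are excluded; otherwise they are included. -/
structure TimeConvention where
  progression : Progression
  divergent : Prop

/-- The requirement on delays imposed by the kind of time progression. -/
def Progression.Holds {A : Type*} (p : Progression) (w : TimedSeq A) : Prop :=
  match p with
  | .weak => True
  | .distinct => ∀ i, 0 < delay w (i + 1)
  | .strong => ∀ i, 0 < delay w i

/-- `w` is an infinite timed word under the given convention. -/
def IsTimedWord {A : Type*} (tc : TimeConvention) (w : TimedSeq A) : Prop :=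
  (Monotone fun i => (w i).2) ∧ tc.progression.Holds w ∧
    (tc.divergent → Filter.Tendsto (fun i => (w i).2) Filter.atTop Filter.atTop)

/-! ### Clocks and guards -/

/-- Clock valuations. -/
abbrev Valuation (C : Type*) := C → ℝ≥0

/-- Guards: Boolean combinations of constraints `x - y ≤ n`, `x - y < n`, with `x` a clock,
`y` a clock or the constant zero (`none`), and `n` a natural number. -/
inductive Guard (C : Type*)
  | tt : Guard C
  | le : C → Option C → ℕ → Guard C
  | lt : C → Option C → ℕ → Guard C
  | not : Guard C → Guard C
  | and : Guard C → Guard C → Guard C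
  | or : Guard C → Guard C → Guard C

/-- The value of a clock or of the constant zero. -/
noncomputable def Valuation.value {C : Type*} (ν : Valuation C) : Option C → ℝ
  | none => 0
  | some y => (ν y : ℝ)

/-- Satisfaction `ν ⊨ g`. -/
def Guard.Sat {C : Type*} (ν : Valuation C) : Guard C → Prop
  | .tt => True
  | .le x y n => (ν x : ℝ) - ν.value y ≤ n
  | .lt x y n => (ν x : ℝ) - ν.value y < n
  | .not g => ¬ g.Sat ν
  | .and g h => g.Sat ν ∧ h.Sat ν
  | .or g h => g.Sat ν ∨ h.Sat ν

/-- `ν + d`. -/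
noncomputable def Valuation.elapse {C : Type*} (ν : Valuation C) (d : ℝ≥0) : Valuation C :=
  fun x => ν x + d

open Classical in
/-- `ν[X → 0]`. -/
noncomputable def Valuation.reset {C : Type*} (ν : Valuation C) (X : Set C) : Valuation C :=
  fun x => if x ∈ X then 0 else ν x

/-! ### Timed automata -/

/-- Transitions `(s, g, a, X, s')`. -/
@[ext]
structure Transition (Q A C : Type*) where
  src : Q
  guard : Guard C
  letter : A
  resets : Set C
  tgt : Q

/-- Timed automata with states `Q`, alphabet `A` and clocks `C` (`Q` and `C` are assumed finite
where timed automata are used; finiteness of `A` follows from the fields). The acceptance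
condition is a set of infinite sequences of transitions. -/
structure TA (Q A C : Type*) where
  init : Q
  trans : Set (Transition Q A C)
  finite_trans : trans.Finite
  complete : ∀ (s : Q) (ν : Valuation C) (a : A),
    ∃ τ ∈ trans, τ.src = s ∧ τ.letter = a ∧ τ.guard.Sat ν
  acc : Set (ℕ → Transition Q A C)

/-- Safety: all visited states are in `F`. (On an infinite run, the visited states are
exactly the sources of its transitions.) -/
def safetyAcc {Q : Type*} (A C : Type*) (F : Set Q) : Set (ℕ → Transition Q A C) :=
  {ρ | ∀ i, (ρ i).src ∈ F}

/-- Reachability: some visited state is in `F`. -/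
def reachAcc {Q : Type*} (A C : Type*) (F : Set Q) : Set (ℕ → Transition Q A C) :=
  {ρ | ∃ i, (ρ i).src ∈ F}

/-- Configurations: a control state and a clock valuation. -/
abbrev Config (Q C : Type*) := Q × Valuation C

namespace TA

variable {Q A C : Type*}

def IsSafety (T : TA Q A C) : Prop := ∃ F : Set Q, T.acc = safetyAcc A C F

def IsReachability (T : TA Q A C) : Prop := ∃ F : Set Q, T.acc = reachAcc A C F

/-- The initial configuration `(ι, 0)`. -/
def initConfig (T : TA Q A C) : Config Q C := (T.init, fun _ => 0)

/-- Delay steps `(s, ν) —d→ (s, ν + d)`. -/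
def DelayStep (c : Config Q C) (d : ℝ≥0) (c' : Config Q C) : Prop :=
  c' = (c.1, c.2.elapse d)

/-- Discrete steps `(s, ν) —τ→ (s', ν[X → 0])` for a transition `τ = (s, g, a, X, s')` of the
automaton with `ν ⊨ g`. -/
def DiscreteStep (T : TA Q A C) (c : Config Q C) (τ : Transition Q A C) (c' : Config Q C) : Prop :=
  τ ∈ T.trans ∧ τ.src = c.1 ∧ τ.guard.Sat c.2 ∧ c' = (τ.tgt, c.2.reset τ.resets)

/-- `ρ` is the sequence of transitions of a (reduced) run from `c` on `w`: the run starts in `c` and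
alternates between the delays of `w` and discrete steps reading the letters of `w`. -/
def IsRun (T : TA Q A C) (c : Config Q C) (w : TimedSeq A) (ρ : ℕ → Transition Q A C) : Prop :=
  ∃ κ κ' : ℕ → Config Q C, κ 0 = c ∧ ∀ i,
    DelayStep (κ i) (delay w i) (κ' i) ∧
    T.DiscreteStep (κ' i) (ρ i) (κ (i + 1)) ∧
    (ρ i).letter = (w i).1

/-- The timed language of a configuration. -/
def langFrom (T : TA Q A C) (tc : TimeConvention) (c : Config Q C) : Set (TimedSeq A) :=
  {w | IsTimedWord tc w ∧ ∃ ρ, T.IsRun c w ρ ∧ ρ ∈ T.acc}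

/-- The timed language of the automaton. -/
def lang (T : TA Q A C) (tc : TimeConvention) : Set (TimedSeq A) :=
  T.langFrom tc T.initConfig

/-- Transitions from the same state on the same letter have mutually exclusive guards. -/
def Deterministic (T : TA Q A C) : Prop :=
  ∀ τ ∈ T.trans, ∀ τ' ∈ T.trans, τ.src = τ'.src → τ.letter = τ'.letter →
    ∀ ν : Valuation C, τ.guard.Sat ν → τ'.guard.Sat ν → τ = τ'

end TA

/-! ### History-determinism -/

/-- A finite run from the initial configuration, given by its delays and transitions. -/
abbrev History (Q A C : Type*) := List (ℝ≥0 × Transition Q A C)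

/-- Candidate resolvers: given the finite run so far, the next delay and the next letter, they
name the next transition. -/
abbrev Strategy (Q A C : Type*) := History Q A C → ℝ≥0 → A → Transition Q A C

/-- The first `i` steps of the run that `r` builds on `w`. -/
noncomputable def Strategy.history {Q A C : Type*} (r : Strategy Q A C) (w : TimedSeq A) :
    ℕ → History Q A C
  | 0 => []
  | i + 1 => r.history w i ++ [(delay w i, r (r.history w i) (delay w i) (w i).1)]

/-- The sequence of transitions that `r` builds on `w`. -/
noncomputable def Strategy.run {Q A C : Type*} (r : Strategy Q A C) (w : TimedSeq A) (i : ℕ) :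
    Transition Q A C :=
  r (r.history w i) (delay w i) (w i).1

namespace TA

variable {Q A C : Type*}

/-- `r` is a resolver: it names transitions of the automaton with the required letter, and on every
word in the language it builds an accepting run on that word. -/
def IsResolver (T : TA Q A C) (tc : TimeConvention) (r : Strategy Q A C) : Prop :=
  (∀ h d a, r h d a ∈ T.trans ∧ (r h d a).letter = a) ∧
  ∀ w ∈ T.lang tc, T.IsRun T.initConfig w (r.run w) ∧ r.run w ∈ T.acc

def HistoryDeterministic (T : TA Q A C) (tc : TimeConvention) : Prop :=
  ∃ r : Strategy Q A C, T.IsResolver tc r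

/-- `T'` arises from `T` by strengthening guards (possibly duplicating or dropping transitions):
same initial state, same acceptance condition, and every transition of `T'` is a transition of `T`
whose guard `g` is replaced by a conjunction `g ∧ z`. -/
def IsGuardRestriction (T' T : TA Q A C) : Prop :=
  T'.init = T.init ∧ T'.acc = T.acc ∧
    ∀ τ' ∈ T'.trans, ∃ τ ∈ T.trans, ∃ z : Guard C, τ' = { τ with guard := τ.guard.and z }

end TA

end TimedAut

namespace TimedAut

/-! ### Order automorphisms of the time line that commute with integer shifts -/

/-- A strictly increasing finite partial map of the real line extends to an order automorphism. -/
theorem exists_orderIso_interpolating {ι : Type*} [Finite ι] [Nonempty ι] (p q : ι → ℝ)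
    (hlt : ∀ i j, p i < p j → q i < q j) (heq : ∀ i j, p i = p j → q i = q j) :
    ∃ e : ℝ ≃o ℝ, ∀ i, e (p i) = q i := by
  classical
  have := Fintype.ofFinite ι
  let r : ι × ι → ℝ := fun x =>
    if p x.1 < p x.2 then (q x.2 - q x.1) / (p x.2 - p x.1) else 1
  have hr : ∀ x, 0 < r x := by
    intro x
    by_cases h : p x.1 < p x.2
    · simp only [r, h, if_true]
      exact div_pos (sub_pos.2 (hlt _ _ h)) (sub_pos.2 h)
    · simp [r, h]
  obtain ⟨xm, hm⟩ := Finite.exists_min r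
  obtain ⟨xM, hM⟩ := Finite.exists_max r
  set δ := r xm with hδ
  set M := r xM with hMM
  have hδ0 : 0 < δ := hr xm
  have hδM : δ ≤ M := hm xM
  have hM0 : 0 < M := hδ0.trans_le hδM
  have hlow : ∀ i j, p i < p j → δ * (p j - p i) ≤ q j - q i := by
    intro i j h
    have := hm (i, j)
    simp only [r, h, if_true] at this
    rwa [← le_div_iff₀ (sub_pos.2 h)]
  have hupp : ∀ i j, p i < p j → q j - q i ≤ M * (p j - p i) := by
    intro i j h
    have := hM (i, j)
    simp only [r, h, if_true] at this
    rwa [← div_le_iff₀ (sub_pos.2 h)]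
  let f : ι → ℝ → ℝ := fun i t => q i + min (δ * (t - p i)) (M * (t - p i))
  have hf : ∀ i, StrictMono (f i) := by
    intro i a b hab
    have h1 : δ * (a - p i) < δ * (b - p i) := by gcongr
    have h2 : M * (a - p i) < M * (b - p i) := by gcongr
    simp only [f]
    have := min_lt_min h1 h2
    linarith
  have hfc : ∀ i, Continuous (f i) := by
    intro i
    simp only [f]
    fun_prop
  let g : ℝ → ℝ := fun t => Finset.univ.sup' Finset.univ_nonempty (fun i => f i t)
  have hg : StrictMono g := by
    intro a b hab
    refine (Finset.sup'_lt_iff _).2 fun i _ => ?_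
    exact (hf i hab).trans_le (Finset.le_sup' (fun i => f i b) (Finset.mem_univ i))
  have hgc : Continuous g := Continuous.finset_sup'_apply _ fun i _ => hfc i
  have hgp : ∀ j, g (p j) = q j := by
    intro j
    apply le_antisymm
    · refine Finset.sup'_le _ _ fun i _ => ?_
      simp only [f]
      rcases lt_trichotomy (p i) (p j) with h | h | h
      · have := hlow i j h
        have := min_le_left (δ * (p j - p i)) (M * (p j - p i))
        linarith
      · simp [h, heq i j h]
      · have := hupp j i h
        have := min_le_right (δ * (p j - p i)) (M * (p j - p i))
        linarith
    · refine le_trans ?_ (Finset.le_sup' (fun i => f i (p j)) (Finset.mem_univ j))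
      simp [f]
  have hgs : Function.Surjective g := by
    intro y
    refine mem_range_of_exists_le_of_exists_ge hgc ?_ ?_
    · obtain ⟨i₀, h₀⟩ := Finite.exists_min (fun i => p i + (y - q i) / δ)
      refine ⟨p i₀ + (y - q i₀) / δ, Finset.sup'_le _ _ fun i _ => ?_⟩
      have h1 := h₀ i
      simp only [f]
      have h2 := min_le_left (δ * (p i₀ + (y - q i₀) / δ - p i)) (M * (p i₀ + (y - q i₀) / δ - p i))
      have h3 : δ * (p i₀ + (y - q i₀) / δ - p i) ≤ δ * ((y - q i) / δ) := by
        gcongr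
        linarith
      rw [mul_div_cancel₀ _ hδ0.ne'] at h3
      linarith
    · let i₀ : ι := Classical.arbitrary ι
      refine ⟨p i₀ + |y - q i₀| / δ, ?_⟩
      refine le_trans ?_ (Finset.le_sup' (fun i => f i _) (Finset.mem_univ i₀))
      simp only [f, add_sub_cancel_left]
      have h0 : 0 ≤ |y - q i₀| / δ := by positivity
      rw [min_eq_left (by gcongr), mul_div_cancel₀ _ hδ0.ne']
      have := le_abs_self (y - q i₀)
      linarith
  exact ⟨hg.orderIsoOfSurjective g hgs, hgp⟩

/-- Order automorphisms of the time line that fix `0` and commute with integer shifts. -/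
structure TimeChange where
  toIso : ℝ ≃o ℝ
  map_zero : toIso 0 = 0
  map_add_one : ∀ x, toIso (x + 1) = toIso x + 1

namespace TimeChange

variable (φ : TimeChange)

theorem map_add_nat (x : ℝ) (n : ℕ) : φ.toIso (x + n) = φ.toIso x + n := by
  induction n with
  | zero => simp
  | succ n ih =>
    push_cast
    rw [← add_assoc, φ.map_add_one, ih, add_assoc]

theorem sub_le_nat_iff (a b : ℝ) (n : ℕ) : φ.toIso b - φ.toIso a ≤ n ↔ b - a ≤ n := by
  rw [sub_le_iff_le_add', ← φ.map_add_nat, φ.toIso.le_iff_le, sub_le_iff_le_add']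

theorem sub_lt_nat_iff (a b : ℝ) (n : ℕ) : φ.toIso b - φ.toIso a < n ↔ b - a < n := by
  rw [sub_lt_iff_lt_add', ← φ.map_add_nat, φ.toIso.lt_iff_lt, sub_lt_iff_lt_add']

theorem nonneg (d : ℝ≥0) : 0 ≤ φ.toIso d := by
  rw [← φ.map_zero]
  exact φ.toIso.monotone d.2

/-- The action on durations. -/
noncomputable def nn (d : ℝ≥0) : ℝ≥0 := ⟨φ.toIso d, φ.nonneg d⟩

@[simp] theorem coe_nn (d : ℝ≥0) : (φ.nn d : ℝ) = φ.toIso d := rfl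

theorem nn_lt_nn {d e : ℝ≥0} : φ.nn d < φ.nn e ↔ d < e := by
  rw [← NNReal.coe_lt_coe, coe_nn, coe_nn, φ.toIso.lt_iff_lt, NNReal.coe_lt_coe]

@[simp] theorem nn_zero : φ.nn 0 = 0 := by
  ext
  simp [φ.map_zero]

theorem nn_pos {d : ℝ≥0} : 0 < φ.nn d ↔ 0 < d := by
  simpa using φ.nn_lt_nn (d := 0) (e := d)

/-- The inverse time change. -/
def symm : TimeChange where
  toIso := φ.toIso.symm
  map_zero := by rw [OrderIso.symm_apply_eq, φ.map_zero]
  map_add_one x := by rw [OrderIso.symm_apply_eq, φ.map_add_one, OrderIso.apply_symm_apply]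

@[simp] theorem nn_symm_nn (d : ℝ≥0) : φ.nn (φ.symm.nn d) = d := by
  ext
  simp [symm]

/-- The time change as seen from the moment `d`. -/
def shift (d : ℝ≥0) : TimeChange where
  toIso := ((OrderIso.addLeft (d : ℝ)).trans φ.toIso).trans (OrderIso.addLeft (-φ.toIso d))
  map_zero := by simp
  map_add_one x := by
    simp [← add_assoc, φ.map_add_one]

theorem shift_apply (d : ℝ≥0) (x : ℝ) :
    (φ.shift d).toIso x = φ.toIso (d + x) - φ.toIso d := by
  simp [shift]
  ring

theorem shift_nn (d e : ℝ≥0) : ((φ.shift d).nn e : ℝ) = φ.nn (d + e) - φ.nn d := by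
  simp [shift_apply]

theorem shift_nn_eq (d e : ℝ≥0) : (φ.shift d).nn e = φ.nn (d + e) - φ.nn d := by
  rw [← NNReal.coe_inj, shift_nn, NNReal.coe_sub]
  rw [← NNReal.coe_le_coe, coe_nn, coe_nn, φ.toIso.le_iff_le]
  simp

end TimeChange

/-- An order automorphism of `ℝ` that fixes `0` and `1` on the unit interval, repeated
periodically. -/
theorem exists_timeChange_extending (e : ℝ ≃o ℝ) (h0 : e 0 = 0) (h1 : e 1 = 1) :
    ∃ φ : TimeChange, ∀ x, φ.toIso x = ⌊x⌋ + e (Int.fract x) := by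
  have hpos : ∀ x : ℝ, 0 ≤ e (Int.fract x) := fun x => by
    rw [← h0]; exact e.monotone (Int.fract_nonneg x)
  have hlt1 : ∀ x : ℝ, e (Int.fract x) < 1 := fun x => by
    rw [← h1]; exact e.strictMono (Int.fract_lt_one x)
  let f : ℝ → ℝ := fun x => ⌊x⌋ + e (Int.fract x)
  have hf : StrictMono f := by
    intro a b hab
    simp only [f]
    rcases (Int.floor_mono hab.le).eq_or_lt with h | h
    · rw [h]
      have : Int.fract a < Int.fract b := by
        unfold Int.fract
        rw [h]
        linarith
      have := e.strictMono this
      linarith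
    · have h' : (⌊a⌋ : ℝ) + 1 ≤ ⌊b⌋ := by exact_mod_cast h
      have := hpos b
      have := hlt1 a
      linarith
  have hs : Function.Surjective f := by
    intro y
    have hx0 : 0 ≤ e.symm (Int.fract y) := by
      rw [e.le_symm_apply, h0]; exact Int.fract_nonneg y
    have hx1 : e.symm (Int.fract y) < 1 := by
      rw [e.symm_apply_lt, h1]; exact Int.fract_lt_one y
    refine ⟨⌊y⌋ + e.symm (Int.fract y), ?_⟩
    have h2 : ⌊(⌊y⌋ : ℝ) + e.symm (Int.fract y)⌋ = ⌊y⌋ := by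
      rw [Int.floor_eq_iff]
      constructor <;> linarith
    have h3 : Int.fract ((⌊y⌋ : ℝ) + e.symm (Int.fract y)) = e.symm (Int.fract y) := by
      rw [Int.fract, h2]; ring
    simp only [f]
    rw [h2, h3, e.apply_symm_apply, Int.floor_add_fract]
  refine ⟨⟨hf.orderIsoOfSurjective f hs, ?_, ?_⟩, fun x => rfl⟩
  · simp [f, h0]
  · intro x
    simp [f]
    ring

/-! ### Region equivalence -/

section Regions

variable {C : Type*}

/-- Two valuations satisfy the same constraints with constants up to `K`. -/
def Agree (K : ℕ) (ν μ : Valuation C) : Prop :=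
  ∀ (x : C) (y : Option C) (n : ℕ), n ≤ K →
    (((ν x : ℝ) - ν.value y ≤ n ↔ (μ x : ℝ) - μ.value y ≤ n) ∧
      ((ν x : ℝ) - ν.value y < n ↔ (μ x : ℝ) - μ.value y < n))

theorem Agree.symm {K : ℕ} {ν μ : Valuation C} (h : Agree K ν μ) : Agree K μ ν :=
  fun x y n hn => ⟨(h x y n hn).1.symm, (h x y n hn).2.symm⟩

theorem Valuation.value_nonneg (ν : Valuation C) (y : Option C) : 0 ≤ ν.value y := by
  cases y <;> simp [Valuation.value]

/-- The constraints of a guard use constants up to `K`. -/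
def Guard.BoundedBy (K : ℕ) : Guard C → Prop
  | .tt => True
  | .le _ _ n => n ≤ K
  | .lt _ _ n => n ≤ K
  | .not g => g.BoundedBy K
  | .and g h => g.BoundedBy K ∧ h.BoundedBy K
  | .or g h => g.BoundedBy K ∧ h.BoundedBy K

theorem Guard.BoundedBy.mono {K L : ℕ} (hKL : K ≤ L) {g : Guard C} (h : g.BoundedBy K) :
    g.BoundedBy L := by
  induction g with
  | tt => trivial
  | le x y n => exact le_trans h hKL
  | lt x y n => exact le_trans h hKL
  | not g ih => exact ih h
  | and g₁ g₂ ih₁ ih₂ => exact ⟨ih₁ h.1, ih₂ h.2⟩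
  | or g₁ g₂ ih₁ ih₂ => exact ⟨ih₁ h.1, ih₂ h.2⟩

theorem Guard.exists_boundedBy (g : Guard C) : ∃ K, g.BoundedBy K := by
  induction g with
  | tt => exact ⟨0, trivial⟩
  | le x y n => exact ⟨n, le_rfl⟩
  | lt x y n => exact ⟨n, le_rfl⟩
  | not g ih => exact ih
  | and g₁ g₂ ih₁ ih₂ =>
    obtain ⟨K₁, h₁⟩ := ih₁
    obtain ⟨K₂, h₂⟩ := ih₂
    exact ⟨max K₁ K₂, h₁.mono (le_max_left _ _), h₂.mono (le_max_right _ _)⟩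
  | or g₁ g₂ ih₁ ih₂ =>
    obtain ⟨K₁, h₁⟩ := ih₁
    obtain ⟨K₂, h₂⟩ := ih₂
    exact ⟨max K₁ K₂, h₁.mono (le_max_left _ _), h₂.mono (le_max_right _ _)⟩

theorem Guard.BoundedBy.sat_iff {K : ℕ} {g : Guard C} (hg : g.BoundedBy K) {ν μ : Valuation C}
    (h : Agree K ν μ) : g.Sat ν ↔ g.Sat μ := by
  induction g with
  | tt => exact Iff.rfl
  | le x y n => exact (h x y n hg).1
  | lt x y n => exact (h x y n hg).2
  | not g ih => exact not_congr (ih hg)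
  | and g₁ g₂ ih₁ ih₂ => exact and_congr (ih₁ hg.1) (ih₂ hg.2)
  | or g₁ g₂ ih₁ ih₂ => exact or_congr (ih₁ hg.1) (ih₂ hg.2)

/-- Truth values of all atomic constraints with constants up to `K`. -/
def signature (K : ℕ) (ν : Valuation C) : C × Option C × Fin (K + 1) → Prop × Prop :=
  fun p => ((ν p.1 : ℝ) - ν.value p.2.1 ≤ (p.2.2 : ℕ), (ν p.1 : ℝ) - ν.value p.2.1 < (p.2.2 : ℕ))

theorem signature_eq_iff {K : ℕ} {ν μ : Valuation C} :
    signature K ν = signature K μ ↔ Agree K ν μ := by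
  constructor
  · intro h x y n hn
    have := congrFun h (x, y, ⟨n, Nat.lt_succ_of_le hn⟩)
    simpa [signature, Prod.ext_iff] using this
  · intro h
    funext p
    obtain ⟨x, y, n⟩ := p
    have := h x y n (Nat.le_of_lt_succ n.2)
    simp [signature, this.1, this.2]

theorem exists_guard_forall {ι : Type*} (s : Set ι) (hs : s.Finite) (P : ι → Valuation C → Prop)
    (hP : ∀ i, ∃ g : Guard C, ∀ ν, g.Sat ν ↔ P i ν) :
    ∃ g : Guard C, ∀ ν, g.Sat ν ↔ ∀ i ∈ s, P i ν := by
  induction s, hs using Set.Finite.induction_on with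
  | empty => exact ⟨.tt, fun ν => by simp [Guard.Sat]⟩
  | @insert i s _ _ ih =>
    obtain ⟨g, hg⟩ := ih
    obtain ⟨h, hh⟩ := hP i
    exact ⟨h.and g, fun ν => by simp [Guard.Sat, hg, hh]⟩

/-- Every union of regions is defined by a guard. -/
theorem exists_guard_of_invariant [Finite C] (K : ℕ) (P : Valuation C → Prop)
    (hP : ∀ ν μ, Agree K ν μ → P ν → P μ) : ∃ g : Guard C, ∀ ν, g.Sat ν ↔ P ν := by
  classical
  have key : ∀ σ : C × Option C × Fin (K + 1) → Prop × Prop,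
      ∃ g : Guard C, ∀ ν, g.Sat ν ↔ signature K ν ≠ σ := by
    intro σ
    obtain ⟨g, hg⟩ := exists_guard_forall (C := C) Set.univ Set.finite_univ
      (fun (p : C × Option C × Fin (K + 1)) ν => signature K ν p = σ p) (by
        intro p
        refine ⟨.and (if (σ p).1 then .le p.1 p.2.1 p.2.2 else .not (.le p.1 p.2.1 p.2.2))
          (if (σ p).2 then .lt p.1 p.2.1 p.2.2 else .not (.lt p.1 p.2.1 p.2.2)), fun ν => ?_⟩
        by_cases h1 : (σ p).1 <;> by_cases h2 : (σ p).2 <;>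
          simp [h1, h2, Guard.Sat, signature, Prod.ext_iff])
    refine ⟨.not g, fun ν => ?_⟩
    simp [Guard.Sat, hg, funext_iff]
  obtain ⟨g, hg⟩ := exists_guard_forall (C := C) {σ | ∃ ν, ¬ P ν ∧ signature K ν = σ}
    (Set.toFinite _) (fun σ ν => signature K ν ≠ σ) key
  refine ⟨g, fun ν => ?_⟩
  rw [hg]
  constructor
  · intro h
    by_contra hν
    exact h _ ⟨ν, hν, rfl⟩ rfl
  · rintro hν σ ⟨μ, hμ, rfl⟩ h
    exact hμ (hP ν μ (signature_eq_iff.1 h) hν)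

/-- `μ` is obtained from `ν` by the time change `φ`, up to clock values beyond `K`. -/
def Sim (K : ℕ) (φ : TimeChange) (ν μ : Valuation C) : Prop :=
  (∀ x, φ.toIso (-(ν x : ℝ)) = -(μ x : ℝ) ∨ ((K : ℝ) < ν x ∧ (K : ℝ) < μ x)) ∧ Agree K ν μ

theorem Sim.symm {K : ℕ} {φ : TimeChange} {ν μ : Valuation C} (h : Sim K φ ν μ) :
    Sim K φ.symm μ ν := by
  refine ⟨fun x => ?_, h.2.symm⟩
  rcases h.1 x with h | h
  · left
    simp [TimeChange.symm, ← h]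
  · exact .inr h.symm

theorem Sim.elapse {K : ℕ} {φ : TimeChange} {ν μ : Valuation C} (h : Sim K φ ν μ) (d : ℝ≥0) :
    Sim K (φ.shift d) (ν.elapse d) (μ.elapse (φ.nn d)) := by
  have hd := φ.nonneg d
  refine ⟨fun x => ?_, fun x y n hn => ?_⟩
  · rcases h.1 x with h | h
    · left
      rw [TimeChange.shift_apply]
      simp [Valuation.elapse, h]
      ring
    · right
      simp only [Valuation.elapse, NNReal.coe_add, TimeChange.coe_nn]
      constructor <;> linarith [h.1, h.2, d.coe_nonneg]
  · cases y with
    | some y => simpa [Valuation.elapse, Valuation.value] using h.2 x (some y) n hn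
    | none =>
      simp only [Valuation.elapse, Valuation.value, NNReal.coe_add, TimeChange.coe_nn, sub_zero]
      rcases h.1 x with h | h
      · have h1 := φ.sub_le_nat_iff (-(ν x : ℝ)) d n
        have h2 := φ.sub_lt_nat_iff (-(ν x : ℝ)) d n
        rw [h, sub_neg_eq_add, sub_neg_eq_add, add_comm, add_comm (d : ℝ)] at h1 h2
        exact ⟨h1.symm, h2.symm⟩
      · have hK : (n : ℝ) ≤ K := by exact_mod_cast hn
        have := d.coe_nonneg
        constructor <;> constructor <;> intro <;> linarith [h.1, h.2]

theorem Sim.reset {K : ℕ} {φ : TimeChange} {ν μ : Valuation C} (h : Sim K φ ν μ) (X : Set C) :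
    Sim K φ (ν.reset X) (μ.reset X) := by
  classical
  refine ⟨fun x => ?_, fun x y n hn => ?_⟩
  · by_cases hx : x ∈ X
    · left
      simp [Valuation.reset, hx, φ.map_zero]
    · simpa [Valuation.reset, hx] using h.1 x
  · have hv : ∀ (ν : Valuation C), (ν.reset X).value y =
        ν.value (y.bind fun z => if z ∈ X then none else some z) := by
      intro ν
      cases y with
      | none => rfl
      | some z => by_cases hz : z ∈ X <;> simp [hz, Valuation.value, Valuation.reset]
    rw [hv, hv]
    generalize (y.bind fun z => if z ∈ X then none else some z) = y'
    by_cases hx : x ∈ X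
    · simp only [Valuation.reset, hx, if_true, NNReal.coe_zero, zero_sub]
      have h1 := ν.value_nonneg y'
      have h2 := μ.value_nonneg y'
      have h0 : (0 : ℝ) ≤ n := n.cast_nonneg
      refine ⟨iff_of_true (by linarith) (by linarith), ?_⟩
      rcases Nat.eq_zero_or_pos n with rfl | hn0
      · cases y' with
        | none => simp [Valuation.value]
        | some z =>
          have := (h.2 z none 0 hn).1
          simp only [Valuation.value, Nat.cast_zero, sub_zero] at this ⊢
          rw [neg_lt_zero, neg_lt_zero, ← not_le, ← not_le, this]
      · have : (0 : ℝ) < n := by exact_mod_cast hn0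
        exact iff_of_true (by linarith) (by linarith)
    · simpa [Valuation.reset, hx] using h.2 x y' n hn

theorem Agree.ceil_eq {K : ℕ} {ν μ : Valuation C} (h : Agree K ν μ) {x : C} (hx : (ν x : ℝ) ≤ K) :
    ⌈(ν x : ℝ)⌉₊ = ⌈(μ x : ℝ)⌉₊ := by
  have hle : ∀ n : ℕ, n ≤ K → ((ν x : ℝ) ≤ n ↔ (μ x : ℝ) ≤ n) := fun n hn => by
    simpa [Valuation.value] using (h x none n hn).1
  have h1 : ⌈(ν x : ℝ)⌉₊ ≤ K := Nat.ceil_le.2 hx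
  have h2 : ⌈(μ x : ℝ)⌉₊ ≤ K := Nat.ceil_le.2 ((hle K le_rfl).1 hx)
  apply le_antisymm
  · exact Nat.ceil_le.2 ((hle _ h2).2 (Nat.le_ceil _))
  · exact Nat.ceil_le.2 ((hle _ h1).1 (Nat.le_ceil _))

/-- Differences of clock values up to `K` (or zero) compare in the same way with integers. -/
theorem Agree.value_sub_lt_iff {K : ℕ} {ν μ : Valuation C} (h : Agree K ν μ) (x y : Option C)
    {m n : ℕ} (hm : m ≤ K) (hn : n ≤ K) :
    ν.value x - ν.value y < (m : ℝ) - n ↔ μ.value x - μ.value y < (m : ℝ) - n := by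
  have hxx : ∀ (x : C) (y : Option C) (n : ℕ), n ≤ K →
      ((ν.value (some x) - ν.value y ≤ n ↔ μ.value (some x) - μ.value y ≤ n) ∧
      (ν.value (some x) - ν.value y < n ↔ μ.value (some x) - μ.value y < n)) := h
  rcases le_total n m with hnm | hnm
  · have hc : (m : ℝ) - n = ((m - n : ℕ) : ℝ) := by rw [Nat.cast_sub hnm]
    rw [hc]
    cases x with
    | some x => exact (hxx x y _ (by omega)).2
    | none =>
      have h1 := ν.value_nonneg y
      have h2 := μ.value_nonneg y
      rcases Nat.eq_zero_or_pos (m - n) with h0 | h0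
      · rw [h0]
        cases y with
        | none => simp [Valuation.value]
        | some y =>
          have := (hxx y none 0 (by omega)).1
          simp only [Valuation.value, Nat.cast_zero, sub_zero, zero_sub] at this ⊢
          rw [neg_lt_zero, neg_lt_zero, ← not_le, ← not_le, this]
      · have h0' : (0 : ℝ) < ((m - n : ℕ) : ℝ) := by exact_mod_cast h0
        simp only [Valuation.value, zero_sub] at *
        exact iff_of_true (by linarith) (by linarith)
  · have hc : (m : ℝ) - n = -((n - m : ℕ) : ℝ) := by rw [Nat.cast_sub hnm]; ring
    have hneg : ∀ a b k : ℝ, a - b < -k ↔ ¬ b - a ≤ k := fun a b k => by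
      rw [not_le]
      constructor <;> intro <;> linarith
    rw [hc, hneg, hneg, not_iff_not]
    cases y with
    | some y => exact (hxx y x _ (by omega)).1
    | none =>
      have h1 := ν.value_nonneg x
      have h2 := μ.value_nonneg x
      have h0 : (0 : ℝ) ≤ ((n - m : ℕ) : ℝ) := Nat.cast_nonneg _
      simp only [Valuation.value, zero_sub] at *
      exact iff_of_true (by linarith) (by linarith)

/-- Region equivalent valuations are related by a time change. -/
theorem Agree.exists_sim [Finite C] {K : ℕ} {ν μ : Valuation C} (h : Agree K ν μ) :
    ∃ φ : TimeChange, Sim K φ ν μ := by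
  let S := {x : Option C // ν.value x ≤ K}
  have hceil : ∀ x : S, ⌈ν.value x.1⌉₊ = ⌈μ.value x.1⌉₊ := by
    rintro ⟨x, hx⟩
    cases x with
    | none => rfl
    | some x => exact h.ceil_eq hx
  have hceilK : ∀ x : S, ⌈ν.value x.1⌉₊ ≤ K := fun x => Nat.ceil_le.2 x.2
  let p : Option S → ℝ := fun o => o.elim 1 fun x => ⌈ν.value x.1⌉₊ - ν.value x.1
  let q : Option S → ℝ := fun o => o.elim 1 fun x => ⌈ν.value x.1⌉₊ - μ.value x.1
  have hp1 : ∀ x : S, p (some x) < 1 := fun x => by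
    have := Nat.ceil_lt_add_one (ν.value_nonneg x.1)
    simp only [p, Option.elim]
    linarith
  have hq1 : ∀ x : S, q (some x) < 1 := fun x => by
    have := Nat.ceil_lt_add_one (μ.value_nonneg x.1)
    simp only [q, Option.elim]
    rw [hceil]
    linarith
  have hpq : ∀ i j, p i < p j ↔ q i < q j := by
    intro i j
    cases i with
    | none =>
      cases j with
      | none => simp [p, q]
      | some y => exact iff_of_false (hp1 y).not_gt (hq1 y).not_gt
    | some x =>
      cases j with
      | none => exact iff_of_true (hp1 x) (hq1 x)
      | some y =>
        have := h.value_sub_lt_iff y.1 x.1 (hceilK y) (hceilK x)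
        simp only [p, q, Option.elim]
        constructor <;> intro h'
        · linarith [this.1 (by linarith)]
        · linarith [this.2 (by linarith)]
  obtain ⟨e, he⟩ := exists_orderIso_interpolating p q (fun i j => (hpq i j).1) (fun i j hij => by
    apply le_antisymm
    · exact not_lt.1 fun h => ((hpq j i).2 h).ne hij.symm
    · exact not_lt.1 fun h => ((hpq i j).2 h).ne hij)
  have h0 : e 0 = 0 := by
    have hz : ((⌈(0 : ℝ)⌉₊ : ℝ) - 0) = 0 := by simp
    have := he (some ⟨none, by simp [Valuation.value]⟩)
    change e ((⌈(0 : ℝ)⌉₊ : ℝ) - 0) = (⌈(0 : ℝ)⌉₊ : ℝ) - 0 at this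
    rwa [hz] at this
  have h1 : e 1 = 1 := he none
  obtain ⟨φ, hφ⟩ := exists_timeChange_extending e h0 h1
  refine ⟨φ, fun x => ?_, h⟩
  by_cases hx : (ν x : ℝ) ≤ K
  · left
    let y : S := ⟨some x, hx⟩
    have hy : Int.fract (-(ν x : ℝ)) = p (some y) := by
      rw [Int.fract_eq_iff]
      refine ⟨?_, hp1 y, -⌈ν.value y.1⌉₊, ?_⟩
      · simp only [p, Option.elim]
        linarith [Nat.le_ceil (ν.value y.1)]
      · simp only [p, y, Option.elim, Valuation.value]
        push_cast
        ring
    have hfl : (⌊-(ν x : ℝ)⌋ : ℝ) = -(ν x : ℝ) - p (some y) := by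
      rw [← hy, Int.self_sub_fract]
    rw [hφ, hfl, hy, he]
    simp only [p, q, y, Option.elim, Valuation.value]
    ring
  · right
    have := (h x none K le_rfl).1
    simp only [Valuation.value, sub_zero] at this
    exact ⟨not_le.1 hx, not_le.1 fun h' => hx (this.2 h')⟩

end Regions

end TimedAut

namespace TimedAut

/-! ### Words given by delays, and their runs -/

section Words

variable {Q A C : Type*}

/-- The infinite sequence with first term `x` and remaining terms `f`. -/
def seqCons {α : Type*} (x : α) (f : ℕ → α) : ℕ → α
  | 0 => x
  | i + 1 => f i

/-- All terms but the first. -/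
def seqTail {α : Type*} (f : ℕ → α) : ℕ → α := fun i => f (i + 1)

/-- Infinite sequences of letters, each with the delay before it. -/
abbrev DelayWord (A : Type*) := ℕ → A × ℝ≥0

/-- The time that passes before and at the first `n` letters. -/
def elapsed (u : DelayWord A) (n : ℕ) : ℝ≥0 := ∑ i ∈ Finset.range n, (u i).2

theorem elapsed_succ (u : DelayWord A) (n : ℕ) : elapsed u (n + 1) = elapsed u n + (u n).2 :=
  Finset.sum_range_succ _ _

theorem elapsed_succ' (u : DelayWord A) (n : ℕ) :
    elapsed u (n + 1) = (u 0).2 + elapsed (seqTail u) n := by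
  rw [elapsed, Finset.sum_range_succ', add_comm]
  rfl

theorem elapsed_mono (u : DelayWord A) : Monotone (elapsed u) :=
  monotone_nat_of_le_succ fun n => by rw [elapsed_succ]; exact le_self_add

theorem elapsed_congr {u v : DelayWord A} {n : ℕ} (h : ∀ j < n, u j = v j) :
    elapsed u n = elapsed v n :=
  Finset.sum_congr rfl fun j hj => by rw [h j (Finset.mem_range.1 hj)]

/-- Zero delays are forbidden after the first letter. -/
def TimeConvention.Later (tc : TimeConvention) : Prop := tc.progression ≠ .weak

/-- The words that may be read from a configuration; the first delay has to be positive
if `q` holds. -/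
def Valid (tc : TimeConvention) (q : Prop) (u : DelayWord A) : Prop :=
  (q → 0 < (u 0).2) ∧ (tc.Later → ∀ i, 0 < (u (i + 1)).2) ∧
    (tc.divergent → ¬ Summable fun i => (u i).2)

theorem valid_iff_seqTail {tc : TimeConvention} {q : Prop} {u : DelayWord A} :
    Valid tc q u ↔ (q → 0 < (u 0).2) ∧ Valid tc tc.Later (seqTail u) := by
  unfold Valid
  have hs : (Summable fun i => (seqTail u i).2) ↔ Summable fun i => (u i).2 :=
    NNReal.summable_nat_add_iff (f := fun i => (u i).2) 1
  rw [hs]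
  refine and_congr_right fun _ => ?_
  rw [← and_assoc]
  refine and_congr_left fun _ => ?_
  constructor
  · exact fun h => ⟨fun hl => h hl 0, fun hl i => h hl (i + 1)⟩
  · rintro ⟨h0, h1⟩ hl i
    cases i with
    | zero => exact h0 hl
    | succ i => exact h1 hl i

theorem Valid.tendsto_elapsed {tc : TimeConvention} {q : Prop} {u : DelayWord A}
    (h : Valid tc q u) (hd : tc.divergent) :
    Filter.Tendsto (elapsed u) Filter.atTop Filter.atTop :=
  NNReal.not_summable_iff_tendsto_nat_atTop.1 (h.2.2 hd)

/-- The configuration after firing a transition. -/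
noncomputable def Transition.fire (τ : Transition Q A C) (ν : Valuation C) : Config Q C :=
  (τ.tgt, ν.reset τ.resets)

/-- The configurations passed when transitions `ρ` are fired on the word `u`. -/
noncomputable def conf (c : Config Q C) (u : DelayWord A) (ρ : ℕ → Transition Q A C) :
    ℕ → Config Q C
  | 0 => c
  | i + 1 => (ρ i).fire ((conf c u ρ i).2.elapse (u i).2)

theorem conf_succ' (c : Config Q C) (u : DelayWord A) (ρ : ℕ → Transition Q A C) (i : ℕ) :
    conf c u ρ (i + 1) =
      conf ((ρ 0).fire (c.2.elapse (u 0).2)) (seqTail u) (seqTail ρ) i := by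
  induction i with
  | zero => rfl
  | succ i ih => rw [conf, ih]; rfl

theorem conf_congr {c : Config Q C} {u v : DelayWord A} {ρ σ : ℕ → Transition Q A C} {n : ℕ}
    (hu : ∀ j < n, u j = v j) (hρ : ∀ j < n, ρ j = σ j) : conf c u ρ n = conf c v σ n := by
  induction n with
  | zero => rfl
  | succ n ih =>
    rw [conf, conf, ih (fun j hj => hu j (by omega)) (fun j hj => hρ j (by omega)),
      hu n (by omega), hρ n (by omega)]

/-- The transition `τ` can be taken in state `s` with clocks `ν` on letter `a`. -/
def TA.Enabled (T : TA Q A C) (s : Q) (ν : Valuation C) (a : A) (τ : Transition Q A C) : Prop :=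
  τ ∈ T.trans ∧ τ.src = s ∧ τ.letter = a ∧ τ.guard.Sat ν

/-- The `i`-th step is possible. -/
def TA.StepAt (T : TA Q A C) (c : Config Q C) (u : DelayWord A) (ρ : ℕ → Transition Q A C)
    (i : ℕ) : Prop :=
  T.Enabled (conf c u ρ i).1 ((conf c u ρ i).2.elapse (u i).2) (u i).1 (ρ i)

/-- `ρ` is a run from `c` on the word `u`. -/
def TA.Run (T : TA Q A C) (c : Config Q C) (u : DelayWord A) (ρ : ℕ → Transition Q A C) : Prop :=
  ∀ i, T.StepAt c u ρ i

theorem TA.stepAt_succ (T : TA Q A C) (c : Config Q C) (u : DelayWord A)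
    (ρ : ℕ → Transition Q A C) (i : ℕ) :
    T.StepAt c u ρ (i + 1) ↔
      T.StepAt ((ρ 0).fire (c.2.elapse (u 0).2)) (seqTail u) (seqTail ρ) i := by
  unfold TA.StepAt
  rw [conf_succ']
  rfl

theorem TA.run_iff_seqTail {T : TA Q A C} {c : Config Q C} {u : DelayWord A}
    {ρ : ℕ → Transition Q A C} :
    T.Run c u ρ ↔ T.Enabled c.1 (c.2.elapse (u 0).2) (u 0).1 (ρ 0) ∧
      T.Run ((ρ 0).fire (c.2.elapse (u 0).2)) (seqTail u) (seqTail ρ) := by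
  constructor
  · exact fun h => ⟨h 0, fun i => (T.stepAt_succ c u ρ i).1 (h (i + 1))⟩
  · rintro ⟨h0, h1⟩ i
    cases i with
    | zero => exact h0
    | succ i => exact (T.stepAt_succ c u ρ i).2 (h1 i)

theorem TA.Run.src_eq {T : TA Q A C} {c : Config Q C} {u : DelayWord A}
    {ρ : ℕ → Transition Q A C} (h : T.Run c u ρ) (i : ℕ) : (ρ i).src = (conf c u ρ i).1 :=
  (h i).2.1

/-- A run whose transitions are chosen by a given selection among the enabled ones. -/
theorem TA.exists_run_of_forall {T : TA Q A C} {P : Q → Valuation C → A → Transition Q A C → Prop}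
    (hP : ∀ s ν a, ∃ τ, T.Enabled s ν a τ ∧ P s ν a τ) (c : Config Q C) (u : DelayWord A) :
    ∃ ρ, T.Run c u ρ ∧
      ∀ i, P (conf c u ρ i).1 ((conf c u ρ i).2.elapse (u i).2) (u i).1 (ρ i) := by
  choose f hf using hP
  let κ : ℕ → Config Q C := fun n => Nat.rec c
    (fun i c => (f c.1 (c.2.elapse (u i).2) (u i).1).fire (c.2.elapse (u i).2)) n
  let ρ : ℕ → Transition Q A C := fun i => f (κ i).1 ((κ i).2.elapse (u i).2) (u i).1
  have hκ : ∀ i, conf c u ρ i = κ i := by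
    intro i
    induction i with
    | zero => rfl
    | succ i ih => rw [conf, ih]
  refine ⟨ρ, fun i => ?_, fun i => ?_⟩
  · unfold TA.StepAt
    rw [hκ]
    exact (hf _ _ _).1
  · rw [hκ]
    exact (hf _ _ _).2

theorem TA.exists_run (T : TA Q A C) (c : Config Q C) (u : DelayWord A) : ∃ ρ, T.Run c u ρ := by
  obtain ⟨ρ, h, -⟩ := TA.exists_run_of_forall (T := T) (P := fun _ _ _ _ => True)
    (fun s ν a => by
      obtain ⟨τ, h1, h2, h3, h4⟩ := T.complete s ν a
      exact ⟨τ, ⟨h1, h2, h3, h4⟩, trivial⟩) c u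
  exact ⟨ρ, h⟩

/-- The words accepted from a configuration. -/
def TA.Acc (T : TA Q A C) (tc : TimeConvention) (q : Prop) (c : Config Q C) :
    Set (DelayWord A) :=
  {u | Valid tc q u ∧ ∃ ρ, T.Run c u ρ ∧ ρ ∈ T.acc}

/-- Constants of guards are bounded by `K`. -/
def TA.BoundedBy (T : TA Q A C) (K : ℕ) : Prop := ∀ τ ∈ T.trans, τ.guard.BoundedBy K

theorem TA.exists_boundedBy (T : TA Q A C) : ∃ K, T.BoundedBy K := by
  choose f hf using fun τ : Transition Q A C => τ.guard.exists_boundedBy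
  obtain ⟨K, hK⟩ := (T.finite_trans.image f).bddAbove
  exact ⟨K, fun τ hτ => (hf τ).mono (hK ⟨τ, hτ, rfl⟩)⟩

theorem TA.BoundedBy.enabled_iff {T : TA Q A C} {K : ℕ} (hK : T.BoundedBy K) {ν μ : Valuation C}
    (h : Agree K ν μ) {s : Q} {a : A} {τ : Transition Q A C} :
    T.Enabled s ν a τ ↔ T.Enabled s μ a τ := by
  refine and_congr_right fun hτ => ?_
  rw [(hK τ hτ).sat_iff h]

/-! ### Time changes of words -/

/-- The word whose time stamps are changed by `φ`. -/
noncomputable def TimeChange.mapWord (φ : TimeChange) (u : DelayWord A) : DelayWord A :=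
  fun i => ((u i).1, φ.nn (elapsed u (i + 1)) - φ.nn (elapsed u i))

theorem TimeChange.nn_mono (φ : TimeChange) : Monotone φ.nn :=
  StrictMono.monotone fun _ _ h => φ.nn_lt_nn.2 h

theorem TimeChange.mapWord_zero (φ : TimeChange) (u : DelayWord A) :
    φ.mapWord u 0 = ((u 0).1, φ.nn (u 0).2) := by
  simp [TimeChange.mapWord, elapsed]

theorem TimeChange.elapsed_mapWord (φ : TimeChange) (u : DelayWord A) (n : ℕ) :
    elapsed (φ.mapWord u) n = φ.nn (elapsed u n) := by
  induction n with
  | zero => simp [elapsed]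
  | succ n ih =>
    rw [elapsed_succ, ih]
    exact add_tsub_cancel_of_le (φ.nn_mono (elapsed_mono u n.le_succ))

theorem TimeChange.seqTail_mapWord (φ : TimeChange) (u : DelayWord A) :
    seqTail (φ.mapWord u) = (φ.shift (u 0).2).mapWord (seqTail u) := by
  funext i
  refine Prod.ext rfl ?_
  simp only [seqTail, TimeChange.mapWord]
  rw [TimeChange.shift_nn_eq, TimeChange.shift_nn_eq, elapsed_succ' u (i + 1), elapsed_succ' u i]
  exact (tsub_tsub_tsub_cancel_right (φ.nn_mono le_self_add)).symm

theorem TimeChange.mapWord_congr (φ : TimeChange) {u v : DelayWord A} {i : ℕ}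
    (h : ∀ j ≤ i, u j = v j) : φ.mapWord u i = φ.mapWord v i := by
  unfold TimeChange.mapWord
  rw [h i le_rfl, elapsed_congr (u := u) (v := v) (n := i + 1) fun j hj => h j (by omega),
    elapsed_congr (u := u) (v := v) (n := i) fun j hj => h j (by omega)]

theorem TimeChange.summable_mapWord_iff (φ : TimeChange) (u : DelayWord A) :
    (Summable fun i => (φ.mapWord u i).2) ↔ Summable fun i => (u i).2 := by
  rw [← not_iff_not, NNReal.not_summable_iff_tendsto_nat_atTop,
    NNReal.not_summable_iff_tendsto_nat_atTop]
  change Filter.Tendsto (elapsed (φ.mapWord u)) _ _ ↔ Filter.Tendsto (elapsed u) _ _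
  rw [← NNReal.tendsto_coe_atTop, ← NNReal.tendsto_coe_atTop]
  simp only [φ.elapsed_mapWord, TimeChange.coe_nn]
  exact φ.toIso.tendsto_atTop_iff

theorem TimeChange.valid_mapWord_iff (φ : TimeChange) (tc : TimeConvention) (q : Prop)
    (u : DelayWord A) : Valid tc q (φ.mapWord u) ↔ Valid tc q u := by
  have hpos : ∀ i, 0 < (φ.mapWord u i).2 ↔ 0 < (u i).2 := by
    intro i
    simp only [TimeChange.mapWord]
    rw [tsub_pos_iff_lt, φ.nn_lt_nn, elapsed_succ, lt_add_iff_pos_right]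
  unfold Valid
  simp only [hpos, φ.summable_mapWord_iff]

theorem Sim.stepAt_iff {T : TA Q A C} {K : ℕ} (hK : T.BoundedBy K) {φ : TimeChange}
    {ν μ : Valuation C} (h : Sim K φ ν μ) (s : Q) (u : DelayWord A) (ρ : ℕ → Transition Q A C)
    (i : ℕ) : T.StepAt (s, ν) u ρ i ↔ T.StepAt (s, μ) (φ.mapWord u) ρ i := by
  induction i generalizing φ ν μ s u ρ with
  | zero =>
    change T.Enabled s (ν.elapse (u 0).2) (u 0).1 (ρ 0) ↔
      T.Enabled s (μ.elapse (φ.mapWord u 0).2) (φ.mapWord u 0).1 (ρ 0)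
    rw [φ.mapWord_zero]
    exact hK.enabled_iff (h.elapse _).2
  | succ i ih =>
    rw [TA.stepAt_succ, TA.stepAt_succ, φ.seqTail_mapWord, φ.mapWord_zero]
    exact ih ((h.elapse _).reset _) _ _ _

theorem Sim.run_iff {T : TA Q A C} {K : ℕ} (hK : T.BoundedBy K) {φ : TimeChange}
    {ν μ : Valuation C} (h : Sim K φ ν μ) (s : Q) (u : DelayWord A) (ρ : ℕ → Transition Q A C) :
    T.Run (s, ν) u ρ ↔ T.Run (s, μ) (φ.mapWord u) ρ :=
  forall_congr' fun i => h.stepAt_iff hK s u ρ i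

theorem Sim.mem_acc_iff {T : TA Q A C} {K : ℕ} (hK : T.BoundedBy K) {φ : TimeChange}
    {ν μ : Valuation C} (h : Sim K φ ν μ) (tc : TimeConvention) (q : Prop) (s : Q)
    (u : DelayWord A) : u ∈ T.Acc tc q (s, ν) ↔ φ.mapWord u ∈ T.Acc tc q (s, μ) := by
  unfold TA.Acc
  simp only [Set.mem_ofPred_eq, φ.valid_mapWord_iff, h.run_iff hK]

/-! ### Winning configurations -/

/-- There is a causal choice of accepting runs from `c` on all words of `M`. -/
def TA.Win (T : TA Q A C) (c : Config Q C) (M : Set (DelayWord A)) : Prop :=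
  ∃ ρ : DelayWord A → ℕ → Transition Q A C,
    (∀ u ∈ M, ∀ v ∈ M, ∀ i, (∀ j ≤ i, u j = v j) → ρ u i = ρ v i) ∧
      ∀ u ∈ M, T.Run c u (ρ u) ∧ ρ u ∈ T.acc

theorem TA.Win.mono {T : TA Q A C} {c : Config Q C} {M N : Set (DelayWord A)} (h : T.Win c N)
    (hMN : M ⊆ N) : T.Win c M := by
  obtain ⟨ρ, h1, h2⟩ := h
  exact ⟨ρ, fun u hu v hv => h1 u (hMN hu) v (hMN hv), fun u hu => h2 u (hMN hu)⟩

/-- The words that are accepted after some transition enabled in `s`, `ν` on `a`. -/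
def TA.Residual (T : TA Q A C) (tc : TimeConvention) (s : Q) (ν : Valuation C) (a : A) :
    Set (DelayWord A) :=
  {u | ∃ τ, T.Enabled s ν a τ ∧ u ∈ T.Acc tc tc.Later (τ.fire ν)}

theorem TA.Win.of_sim {T : TA Q A C} {K : ℕ} (hK : T.BoundedBy K) {φ : TimeChange}
    {ν μ : Valuation C} (h : Sim K φ ν μ) {s : Q} {M N : Set (DelayWord A)}
    (hMN : ∀ u ∈ M, φ.mapWord u ∈ N) (hw : T.Win (s, μ) N) : T.Win (s, ν) M := by
  obtain ⟨ρ, h1, h2⟩ := hw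
  refine ⟨fun u => ρ (φ.mapWord u), fun u hu v hv i huv => ?_, fun u hu => ?_⟩
  · exact h1 _ (hMN u hu) _ (hMN v hv) i fun j hj =>
      φ.mapWord_congr fun k hk => huv k (hk.trans hj)
  · rw [h.run_iff hK]
    exact h2 _ (hMN u hu)

/-- The winning condition for the residual language depends only on the region. -/
theorem TA.Win.residual_of_agree [Finite C] {T : TA Q A C} {K : ℕ} (hK : T.BoundedBy K)
    {tc : TimeConvention} {ν μ : Valuation C} (h : Agree K ν μ) {s : Q} {a : A}
    {τ : Transition Q A C} (hw : T.Win (τ.fire ν) (T.Residual tc s ν a)) :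
    T.Win (τ.fire μ) (T.Residual tc s μ a) := by
  obtain ⟨φ, hφ⟩ := h.symm.exists_sim
  refine TA.Win.of_sim hK (hφ.reset τ.resets) ?_ hw
  rintro u ⟨τ', he, hu⟩
  exact ⟨τ', (hK.enabled_iff h).2 he, ((hφ.reset τ'.resets).mem_acc_iff hK _ _ _ _).1 hu⟩

/-- Visits to `s` do not influence acceptance. -/
def TA.Neutral (T : TA Q A C) (s : Q) : Prop :=
  ∀ ρ : ℕ → Transition Q A C, (ρ 0).src = s → (ρ ∈ T.acc ↔ seqTail ρ ∈ T.acc)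

/-- In a neutral state, the words accepted after a step are those of the residual language. -/
theorem TA.Neutral.mem_acc_iff {T : TA Q A C} {tc : TimeConvention} {q : Prop} {c : Config Q C}
    (hs : T.Neutral c.1) {u : DelayWord A} :
    u ∈ T.Acc tc q c ↔ (q → 0 < (u 0).2) ∧
      seqTail u ∈ T.Residual tc c.1 (c.2.elapse (u 0).2) (u 0).1 := by
  constructor
  · rintro ⟨hv, ρ, hρ, ha⟩
    rw [valid_iff_seqTail] at hv
    have hρ' := TA.run_iff_seqTail.1 hρ
    exact ⟨hv.1, ρ 0, hρ'.1, hv.2, seqTail ρ, hρ'.2, (hs ρ hρ'.1.2.1).1 ha⟩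
  · rintro ⟨hq, τ, he, hv, ρ, hρ, ha⟩
    refine ⟨valid_iff_seqTail.2 ⟨hq, hv⟩, seqCons τ ρ, TA.run_iff_seqTail.2 ⟨he, hρ⟩, ?_⟩
    exact (hs _ he.2.1).2 ha

/-- From a winning configuration, some transition leads to a configuration that wins the
residual language. -/
theorem TA.Win.exists_residual {T : TA Q A C} {tc : TimeConvention} {q : Prop} {c : Config Q C}
    (hs : T.Neutral c.1) (hw : T.Win c (T.Acc tc q c)) {u : DelayWord A}
    (hu : u ∈ T.Acc tc q c) :
    ∃ τ, T.Enabled c.1 (c.2.elapse (u 0).2) (u 0).1 τ ∧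
      T.Win (τ.fire (c.2.elapse (u 0).2)) (T.Residual tc c.1 (c.2.elapse (u 0).2) (u 0).1) := by
  obtain ⟨ρ, h1, h2⟩ := hw
  have hq := hu.1.1
  have hmem : ∀ v ∈ T.Residual tc c.1 (c.2.elapse (u 0).2) (u 0).1,
      seqCons (u 0) v ∈ T.Acc tc q c := fun v hv => hs.mem_acc_iff.2 ⟨hq, hv⟩
  have hfirst : ∀ v ∈ T.Residual tc c.1 (c.2.elapse (u 0).2) (u 0).1,
      ρ (seqCons (u 0) v) 0 = ρ u 0 := fun v hv =>
    h1 _ (hmem v hv) _ hu 0 fun j hj => by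
      obtain rfl : j = 0 := by omega
      rfl
  refine ⟨ρ u 0, (h2 u hu).1 0, fun v => seqTail (ρ (seqCons (u 0) v)), ?_, ?_⟩
  · intro v hv w hw i hvw
    refine h1 _ (hmem v hv) _ (hmem w hw) (i + 1) fun j hj => ?_
    cases j with
    | zero => rfl
    | succ j => exact hvw j (by omega)
  · intro v hv
    obtain ⟨hrun, hacc⟩ := h2 _ (hmem v hv)
    have h' := TA.run_iff_seqTail.1 hrun
    refine ⟨?_, (hs _ h'.1.2.1).1 hacc⟩
    have := h'.2
    rwa [hfirst v hv] at this

end Words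

end TimedAut

namespace TimedAut

/-! ### Reaching a set of states before a deadline -/

section Reach

variable {Q A C : Type*}

/-- From `c` one can choose transitions so that `X` is visited after at least one letter, at the
latest with the first letter that arrives at time `θ` or later. If Zeno words are allowed, `X` has
to be visited with the first letter. -/
def TA.Deadline (T : TA Q A C) (tc : TimeConvention) (X : Config Q C → Prop) (θ : ℝ≥0)
    (c : Config Q C) : Prop :=
  ∃ R : ℝ≥0 → Config Q C → Prop, R θ c ∧ ∀ θ c, R θ c → ∀ d, (tc.Later → 0 < d) → ∀ a,
    ∃ τ, T.Enabled c.1 (c.2.elapse d) a τ ∧ (X (τ.fire (c.2.elapse d)) ∨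
      (tc.divergent ∧ d < θ ∧ R (θ - d) (τ.fire (c.2.elapse d))))

theorem TA.Deadline.step {T : TA Q A C} {tc : TimeConvention} {X : Config Q C → Prop} {θ : ℝ≥0}
    {c : Config Q C} (h : T.Deadline tc X θ c) {d : ℝ≥0} (hd : tc.Later → 0 < d) (a : A) :
    ∃ τ, T.Enabled c.1 (c.2.elapse d) a τ ∧ (X (τ.fire (c.2.elapse d)) ∨
      (tc.divergent ∧ d < θ ∧ T.Deadline tc X (θ - d) (τ.fire (c.2.elapse d)))) := by
  obtain ⟨R, hR, hstep⟩ := h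
  obtain ⟨τ, he, h⟩ := hstep θ c hR d hd a
  exact ⟨τ, he, h.imp_right fun h => ⟨h.1, h.2.1, R, h.2.2, hstep⟩⟩

theorem TA.Deadline.mono {T : TA Q A C} {tc : TimeConvention} {X : Config Q C → Prop} {θ η : ℝ≥0}
    (hθη : θ ≤ η) {c : Config Q C} (h : T.Deadline tc X θ c) : T.Deadline tc X η c := by
  refine ⟨fun η c => ∃ θ ≤ η, T.Deadline tc X θ c, ⟨θ, hθη, h⟩, ?_⟩
  rintro η c ⟨θ, hθη, h⟩ d hd a
  obtain ⟨τ, he, h⟩ := h.step hd a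
  exact ⟨τ, he, h.imp_right fun h =>
    ⟨h.1, h.2.1.trans_le hθη, θ - d, tsub_le_tsub_right hθη d, h.2.2⟩⟩

theorem TA.Deadline.of_sim {T : TA Q A C} {tc : TimeConvention} {X : Config Q C → Prop} {K : ℕ}
    (hK : T.BoundedBy K)
    (hX : ∀ (φ : TimeChange) (ν μ : Valuation C) (s : Q), Sim K φ ν μ → X (s, ν) → X (s, μ))
    {φ : TimeChange} {ν μ : Valuation C} (hφ : Sim K φ ν μ) {θ : ℝ≥0} {s : Q}
    (h : T.Deadline tc X θ (s, ν)) : T.Deadline tc X (φ.nn θ) (s, μ) := by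
  refine ⟨fun θ' c => ∃ (φ : TimeChange) (ν : Valuation C) (θ : ℝ≥0),
    Sim K φ ν c.2 ∧ T.Deadline tc X θ (c.1, ν) ∧ θ' = φ.nn θ, ⟨φ, ν, θ, hφ, h, rfl⟩, ?_⟩
  rintro _ ⟨s, μ⟩ ⟨φ, ν, θ, hφ, h, rfl⟩ d' hd' a
  obtain ⟨d, rfl⟩ : ∃ d, φ.nn d = d' := ⟨_, φ.nn_symm_nn d'⟩
  have hd : tc.Later → 0 < d := fun hl => φ.nn_pos.1 (hd' hl)
  have hs := hφ.elapse d
  obtain ⟨τ, he, h⟩ := h.step hd a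
  refine ⟨τ, (hK.enabled_iff hs.2).1 he, h.imp (fun h => ?_) fun h => ?_⟩
  · exact hX _ _ _ _ (hs.reset τ.resets) h
  · refine ⟨h.1, φ.nn_lt_nn.2 h.2.1, φ.shift d, _, θ - d, hs.reset τ.resets, h.2.2, ?_⟩
    rw [TimeChange.shift_nn_eq, add_tsub_cancel_of_le h.2.1.le]

/-- The set `F` can be reached in `n` phases, the first of which ends before the deadline `θ`. -/
def TA.Phases (T : TA Q A C) (tc : TimeConvention) (F : Set Q) : ℕ → ℝ≥0 → Config Q C → Prop
  | 0 => fun _ c => c.1 ∈ F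
  | n + 1 => fun θ c => (∃ η, T.Phases tc F n η c) ∨
      T.Deadline tc (fun c => ∃ η, T.Phases tc F n η c) θ c

/-- The set `F` can be reached in `n` phases. -/
def TA.Rank (T : TA Q A C) (tc : TimeConvention) (F : Set Q) (n : ℕ) (c : Config Q C) : Prop :=
  ∃ θ, T.Phases tc F n θ c

theorem TA.Rank.phases_succ {T : TA Q A C} {tc : TimeConvention} {F : Set Q} {n : ℕ}
    {c : Config Q C} (h : T.Rank tc F n c) (θ : ℝ≥0) : T.Phases tc F (n + 1) θ c := .inl h

theorem TA.rank_mono (T : TA Q A C) (tc : TimeConvention) (F : Set Q) (c : Config Q C) {m n : ℕ}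
    (hmn : m ≤ n) (h : T.Rank tc F m c) : T.Rank tc F n c := by
  induction n, hmn using Nat.le_induction with
  | base => exact h
  | succ n _ ih => exact ⟨0, ih.phases_succ 0⟩

theorem TA.Phases.mono {T : TA Q A C} {tc : TimeConvention} {F : Set Q} {n : ℕ} {θ η : ℝ≥0}
    (hθη : θ ≤ η) {c : Config Q C} (h : T.Phases tc F n θ c) : T.Phases tc F n η c := by
  cases n with
  | zero => exact h
  | succ n => exact h.imp_right fun h => h.mono hθη

theorem TA.Phases.of_sim {T : TA Q A C} {tc : TimeConvention} {F : Set Q} {K : ℕ}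
    (hK : T.BoundedBy K) {n : ℕ} {φ : TimeChange} {ν μ : Valuation C} (hφ : Sim K φ ν μ) {θ : ℝ≥0}
    {s : Q} (h : T.Phases tc F n θ (s, ν)) : T.Phases tc F n (φ.nn θ) (s, μ) := by
  induction n generalizing φ ν μ θ s with
  | zero => exact h
  | succ n ih =>
    rcases h with ⟨η, h⟩ | h
    · exact .inl ⟨φ.nn η, ih hφ h⟩
    · exact .inr (h.of_sim hK (fun φ ν μ s hφ ⟨η, h⟩ => ⟨φ.nn η, ih hφ h⟩) hφ)

theorem TA.Rank.of_agree [Finite C] {T : TA Q A C} {tc : TimeConvention} {F : Set Q} {K : ℕ}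
    (hK : T.BoundedBy K) {n : ℕ} {ν μ : Valuation C} (h : Agree K ν μ) {s : Q}
    (hr : T.Rank tc F n (s, ν)) : T.Rank tc F n (s, μ) := by
  obtain ⟨φ, hφ⟩ := h.exists_sim
  obtain ⟨θ, hr⟩ := hr
  exact ⟨φ.nn θ, hr.of_sim hK hφ⟩

/-- Ranks are bounded, as there are finitely many regions. -/
theorem TA.exists_rank_bound [Finite Q] [Finite C] (T : TA Q A C) (tc : TimeConvention)
    (F : Set Q) : ∃ N, ∀ n c, T.Rank tc F n c → T.Rank tc F N c := by
  obtain ⟨K, hK⟩ := T.exists_boundedBy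
  let S : ℕ →o Set (Q × (C × Option C × Fin (K + 1) → Prop × Prop)) :=
    ⟨fun n => {p | ∃ ν, signature K ν = p.2 ∧ T.Rank tc F n (p.1, ν)}, by
      rintro m n hmn p ⟨ν, hν, h⟩
      exact ⟨ν, hν, T.rank_mono tc F _ hmn h⟩⟩
  obtain ⟨N, hN⟩ := WellFoundedGT.monotone_chain_condition S
  refine ⟨N, fun n c h => ?_⟩
  rcases le_total n N with hn | hn
  · exact T.rank_mono tc F c hn h
  · have hc : (c.1, signature K c.2) ∈ S n := ⟨c.2, rfl, h⟩
    rw [← hN n hn] at hc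
    obtain ⟨ν, hν, h⟩ := hc
    exact h.of_agree hK (signature_eq_iff.1 hν)

/-- The transition `τ` is at least as quick as every other enabled transition. -/
def TA.Quickest (T : TA Q A C) (tc : TimeConvention) (F : Set Q) (s : Q) (ν : Valuation C) (a : A)
    (τ : Transition Q A C) : Prop :=
  ∀ τ', T.Enabled s ν a τ' → ∀ n θ, T.Phases tc F n θ (τ'.fire ν) → T.Phases tc F n θ (τ.fire ν)

theorem TA.exists_quickest (T : TA Q A C) (tc : TimeConvention) (F : Set Q) (s : Q)
    (ν : Valuation C) (a : A) : ∃ τ, T.Enabled s ν a τ ∧ T.Quickest tc F s ν a τ := by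
  let f : Transition Q A C → Set (ℕ ×ₗ ℝ≥0) := fun τ =>
    {p | T.Phases tc F (ofLex p).1 (ofLex p).2 (τ.fire ν)}
  have hf : ∀ τ, IsUpperSet (f τ) := by
    intro τ p p' hpp' hp
    rcases Prod.Lex.le_iff.1 hpp' with h | ⟨h1, h2⟩
    · have h1 : T.Rank tc F (ofLex p).1 (τ.fire ν) := ⟨_, hp⟩
      obtain ⟨m, hm⟩ : ∃ m, (ofLex p').1 = m + 1 := ⟨(ofLex p').1 - 1, by omega⟩
      change T.Phases tc F (ofLex p').1 _ _
      rw [hm] at h ⊢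
      exact (T.rank_mono tc F _ (Nat.le_of_lt_succ h) h1).phases_succ _
    · change T.Phases tc F (ofLex p').1 _ _
      rw [← h1]
      exact TA.Phases.mono h2 hp
  have hfin : {τ | T.Enabled s ν a τ}.Finite := T.finite_trans.subset fun τ h => h.1
  have hne : {τ | T.Enabled s ν a τ}.Nonempty := by
    obtain ⟨τ, h1, h2, h3, h4⟩ := T.complete s ν a
    exact ⟨τ, h1, h2, h3, h4⟩
  obtain ⟨τ, hτ, hmax⟩ := hfin.exists_maximalFor f _ hne
  refine ⟨τ, hτ, fun τ' hτ' n θ h => ?_⟩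
  have hle : f τ' ⊆ f τ := by
    rcases (hf τ').total (hf τ) with h | h
    · exact h
    · exact hmax hτ' h
  exact hle (show toLex (n, θ) ∈ f τ' from h)

theorem TA.Quickest.of_agree [Finite C] {T : TA Q A C} {tc : TimeConvention} {F : Set Q} {K : ℕ}
    (hK : T.BoundedBy K) {ν μ : Valuation C} (h : Agree K ν μ) {s : Q} {a : A}
    {τ : Transition Q A C} (hq : T.Quickest tc F s ν a τ) : T.Quickest tc F s μ a τ := by
  obtain ⟨φ, hφ⟩ := h.exists_sim
  intro τ' hτ' n θ hp
  have h1 := hq τ' ((hK.enabled_iff h).2 hτ') n _ (TA.Phases.of_sim hK (hφ.reset τ'.resets).symm hp)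
  have h2 := TA.Phases.of_sim hK (hφ.reset τ.resets) h1
  rwa [φ.nn_symm_nn] at h2

/-- Quickest transitions lead to `F`. -/
theorem TA.Rank.exists_mem {T : TA Q A C} {tc : TimeConvention} {F : Set Q} {c : Config Q C}
    {u : DelayWord A} {q : Prop} (hq : tc.Later → q) (hu : Valid tc q u)
    {ρ : ℕ → Transition Q A C} (hρ : T.Run c u ρ)
    (hQ : ∀ i, T.Quickest tc F (conf c u ρ i).1 ((conf c u ρ i).2.elapse (u i).2) (u i).1 (ρ i))
    {n i : ℕ} (h : T.Rank tc F n (conf c u ρ i)) : ∃ j, (ρ j).src ∈ F := by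
  induction n generalizing i with
  | zero =>
    obtain ⟨_, h⟩ := h
    exact ⟨i, by rw [hρ.src_eq]; exact h⟩
  | succ n ih =>
    by_contra hno
    have hW : ∀ j, ¬ T.Rank tc F n (conf c u ρ j) := fun j hj => hno (ih hj)
    have hpos : ∀ j, tc.Later → 0 < (u j).2 := by
      intro j hl
      cases j with
      | zero => exact hu.1 (hq hl)
      | succ j => exact hu.2.1 hl j
    have hstep : ∀ j θ, T.Deadline tc (T.Rank tc F n) θ (conf c u ρ j) →
        tc.divergent ∧ (u j).2 < θ ∧
          T.Deadline tc (T.Rank tc F n) (θ - (u j).2) (conf c u ρ (j + 1)) := by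
      intro j θ hD
      obtain ⟨τ, he, h | h⟩ := hD.step (hpos j) (u j).1
      · obtain ⟨η, h⟩ := h
        exact absurd ⟨η, hQ j τ he n η h⟩ (hW (j + 1))
      · refine ⟨h.1, h.2.1, ?_⟩
        rcases hQ j τ he (n + 1) _ (.inr h.2.2) with h | h
        · exact absurd h (hW (j + 1))
        · exact h
    obtain ⟨θ, h | h⟩ := h
    · exact hW i h
    · have hd := (hstep i θ h).1
      have hall : ∀ k, ∃ η, T.Deadline tc (T.Rank tc F n) η (conf c u ρ (i + k)) ∧
          η + elapsed u (i + k) = θ + elapsed u i := by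
        intro k
        induction k with
        | zero => exact ⟨θ, h, rfl⟩
        | succ k ihk =>
          obtain ⟨η, h1, h2⟩ := ihk
          obtain ⟨-, h3, h4⟩ := hstep _ _ h1
          refine ⟨η - (u (i + k)).2, h4, ?_⟩
          rw [← h2, ← add_assoc, elapsed_succ, add_comm (elapsed u (i + k)), ← add_assoc,
            tsub_add_cancel_of_le h3.le]
      obtain ⟨m, hm⟩ := ((hu.tendsto_elapsed hd).eventually_gt_atTop (θ + elapsed u i)).exists
      obtain ⟨η, -, h2⟩ := hall m
      have h3 : elapsed u m ≤ elapsed u (i + m) := elapsed_mono u (by omega)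
      have h4 : elapsed u (i + m) ≤ θ + elapsed u i := h2 ▸ le_add_self
      exact absurd (h3.trans h4) (not_le.2 hm)

theorem valid_later_iff {tc : TimeConvention} {u : DelayWord A} :
    Valid tc tc.Later u ↔ (tc.Later → ∀ i, 0 < (u i).2) ∧
      (tc.divergent → ¬ Summable fun i => (u i).2) := by
  constructor
  · rintro ⟨h0, h1, h2⟩
    refine ⟨fun hl i => ?_, h2⟩
    cases i with
    | zero => exact h0 hl
    | succ i => exact h1 hl i
  · exact fun h => ⟨fun hl => h.1 hl 0, fun hl i => h.1 hl (i + 1), h.2⟩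

/-- A word with prescribed prefix and next letter. -/
theorem Valid.exists_extension {tc : TimeConvention} {u : DelayWord A}
    (hu : Valid tc tc.Later u) (k : ℕ) {d : ℝ≥0} (hd : tc.Later → 0 < d) (a : A) :
    ∃ v : DelayWord A, Valid tc tc.Later v ∧ (∀ j < k, v j = u j) ∧ v k = (a, d) := by
  rw [valid_later_iff] at hu
  let v : DelayWord A := fun i => if i < k then u i else if i = k then (a, d) else (a, 1)
  refine ⟨v, valid_later_iff.2 ⟨fun hl i => ?_, fun _ hs => ?_⟩, fun j hj => by simp [v, hj],
    by simp [v]⟩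
  · by_cases h1 : i < k
    · simpa [v, h1] using hu.1 hl i
    · by_cases h2 : i = k
      · simpa [v, h2] using hd hl
      · simp [v, h1, h2]
  · have h0 := (NNReal.tendsto_atTop_zero_of_summable hs)
    have h1 : Filter.Tendsto (fun i => (v i).2) Filter.atTop (nhds 1) := by
      refine tendsto_const_nhds.congr' ?_
      filter_upwards [Filter.eventually_gt_atTop k] with i hi
      have h2 : ¬ i < k := by omega
      have h3 : i ≠ k := by omega
      simp [v, h2, h3]
    exact zero_ne_one (tendsto_nhds_unique h0 h1)

/-- A word on which a causal choice of runs avoids `X` for one more phase. -/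
theorem TA.exists_longer_avoiding {T : TA Q A C} {tc : TimeConvention} {c : Config Q C}
    {X : Config Q C → Prop} (hX : ∀ c, T.Deadline tc X 1 c → X c)
    {ρ : DelayWord A → ℕ → Transition Q A C}
    (hcaus : ∀ u v : DelayWord A, Valid tc tc.Later u → Valid tc tc.Later v → ∀ k,
      (∀ j < k, u j = v j) → conf c u (ρ u) k = conf c v (ρ v) k)
    (hrun : ∀ u, Valid tc tc.Later u → T.Run c u (ρ u)) {u : DelayWord A}
    (hu : Valid tc tc.Later u) {k : ℕ} (huX : ∀ j ≤ k, ¬ X (conf c u (ρ u) j)) :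
    ∃ (v : DelayWord A) (l : ℕ), (Valid tc tc.Later v ∧ ∀ j ≤ l, ¬ X (conf c v (ρ v) j)) ∧
      k < l ∧ (∀ j < k, v j = u j) ∧ (tc.divergent → elapsed u k + 1 ≤ elapsed v l) := by
  by_contra hno
  refine huX k le_rfl (hX _ ⟨fun θ c' => ∃ (v : DelayWord A) (l : ℕ), Valid tc tc.Later v ∧
    (∀ j ≤ l, ¬ X (conf c v (ρ v) j)) ∧ k ≤ l ∧ (∀ j < k, v j = u j) ∧
    c' = conf c v (ρ v) l ∧ θ + elapsed v l = elapsed u k + 1,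
    ⟨u, k, hu, huX, le_rfl, fun _ _ => rfl, rfl, add_comm _ _⟩, ?_⟩)
  rintro θ _ ⟨v, l, hv, hvX, hkl, hvu, rfl, hθ⟩ d hd a
  obtain ⟨w, hw, hwv, hwl⟩ := hv.exists_extension l hd a
  have hagree : ∀ j ≤ l, conf c w (ρ w) j = conf c v (ρ v) j := fun j hj =>
    hcaus w v hw hv j fun i hi => hwv i (by omega)
  have hfire : conf c w (ρ w) (l + 1) = (ρ w l).fire ((conf c v (ρ v) l).2.elapse d) := by
    rw [conf, hagree l le_rfl, hwl]
  have hel : elapsed w (l + 1) = elapsed v l + d := by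
    rw [elapsed_succ, elapsed_congr hwv, hwl]
  refine ⟨ρ w l, ?_, ?_⟩
  · have := hrun w hw l
    unfold TA.StepAt at this
    rwa [hagree l le_rfl, hwl] at this
  · rw [← hfire]
    by_cases hXw : X (conf c w (ρ w) (l + 1))
    · exact .inl hXw
    · right
      have hwX : ∀ j ≤ l + 1, ¬ X (conf c w (ρ w) j) := by
        intro j hj
        rcases hj.lt_or_eq with h | rfl
        · rw [hagree j (by omega)]
          exact hvX j (by omega)
        · exact hXw
      have hwu : ∀ j < k, w j = u j := fun j hj => (hwv j (by omega)).trans (hvu j hj)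
      have hno' : ¬ (tc.divergent → elapsed u k + 1 ≤ elapsed w (l + 1)) := fun h =>
        hno ⟨w, l + 1, ⟨hw, hwX⟩, by omega, hwu, h⟩
      rw [Classical.not_imp, hel, not_le, ← hθ] at hno'
      have hdθ : d < θ := by
        rw [add_comm θ] at hno'
        exact lt_of_add_lt_add_left hno'.2
      refine ⟨hno'.1, hdθ, w, l + 1, hw, hwX, by omega, hwu, rfl, ?_⟩
      rw [hel, ← hθ, add_comm _ d, ← add_assoc, tsub_add_cancel_of_le hdθ.le]

/-- If all words can be accepted, then `F` can be reached in finitely many phases. -/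
theorem TA.Win.exists_rank [Finite Q] [Finite C] {T : TA Q A C} {tc : TimeConvention} {F : Set Q}
    (hF : T.acc = reachAcc A C F) {c : Config Q C}
    (hw : T.Win c {u | Valid tc tc.Later u}) : ∃ n, T.Rank tc F n c := by
  obtain ⟨N, hN⟩ := T.exists_rank_bound tc F
  refine ⟨N, ?_⟩
  by_contra hc
  set X := T.Rank tc F N with hXdef
  have hX : ∀ c θ, T.Deadline tc X θ c → X c := fun c θ h => hN (N + 1) c ⟨θ, .inr h⟩
  obtain ⟨a⟩ : Nonempty A := by
    by_contra hA
    exact hc (hX c 0 ⟨fun _ _ => True, trivial, fun _ _ _ _ _ a => (hA ⟨a⟩).elim⟩)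
  obtain ⟨ρ, h1, h2⟩ := hw
  have hcaus : ∀ u v : DelayWord A, Valid tc tc.Later u → Valid tc tc.Later v → ∀ k,
      (∀ j < k, u j = v j) → conf c u (ρ u) k = conf c v (ρ v) k := fun u v hu hv k huv =>
    conf_congr huv fun i hi => h1 u hu v hv i fun j hj => huv j (by omega)
  let S := {p : DelayWord A × ℕ // Valid tc tc.Later p.1 ∧ ∀ j ≤ p.2, ¬ X (conf c p.1 (ρ p.1) j)}
  have hnext : ∀ p : S, ∃ p' : S, p.1.2 < p'.1.2 ∧ (∀ j < p.1.2, p'.1.1 j = p.1.1 j) ∧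
      (tc.divergent → elapsed p.1.1 p.1.2 + 1 ≤ elapsed p'.1.1 p'.1.2) := by
    rintro ⟨⟨u, k⟩, hu, huX⟩
    obtain ⟨v, l, hv, h⟩ := TA.exists_longer_avoiding (fun c => hX c 1) hcaus
      (fun u hu => (h2 u hu).1) hu huX
    exact ⟨⟨(v, l), hv⟩, h⟩
  choose next hlt hagree htime using hnext
  have hstart : Valid tc tc.Later fun _ : ℕ => (a, (1 : ℝ≥0)) := by
    refine valid_later_iff.2 ⟨fun _ _ => one_pos, fun _ hs => ?_⟩
    exact one_ne_zero (tendsto_nhds_unique tendsto_const_nhds (NNReal.tendsto_atTop_zero_of_summable hs))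
  let st : ℕ → S := fun n => Nat.rec
    ⟨(fun _ => (a, 1), 0), hstart, fun j hj => by
      obtain rfl : j = 0 := by omega
      exact hc⟩ (fun _ p => next p) n
  have hst : ∀ n, st (n + 1) = next (st n) := fun _ => rfl
  have hle : ∀ n, n ≤ (st n).1.2 := by
    intro n
    induction n with
    | zero => exact Nat.zero_le _
    | succ n ih =>
      have := hlt (st n)
      rw [hst]
      omega
  have hmono : ∀ m n, m ≤ n → (st m).1.2 ≤ (st n).1.2 ∧
      ∀ j < (st m).1.2, (st n).1.1 j = (st m).1.1 j := by
    intro m n hmn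
    induction n, hmn using Nat.le_induction with
    | base => exact ⟨le_rfl, fun _ _ => rfl⟩
    | succ n _ ih =>
      rw [hst]
      exact ⟨ih.1.trans (hlt _).le, fun j hj =>
        (hagree _ j (hj.trans_le ih.1)).trans (ih.2 j hj)⟩
  have helapsed : tc.divergent → ∀ n : ℕ, (n : ℝ≥0) ≤ elapsed (st n).1.1 (st n).1.2 := by
    intro hd n
    induction n with
    | zero => simp
    | succ n ih =>
      rw [hst]
      push_cast
      exact (add_le_add_left ih 1).trans (htime _ hd)
  let w : DelayWord A := fun i => (st (i + 1)).1.1 i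
  have hw : ∀ n, ∀ i < (st n).1.2, w i = (st n).1.1 i := by
    intro n i hi
    rcases le_total n (i + 1) with h | h
    · exact (hmono _ _ h).2 i hi
    · exact ((hmono _ _ h).2 i (hle (i + 1))).symm
  have hwv : Valid tc tc.Later w := by
    refine valid_later_iff.2 ⟨fun hl i => (valid_later_iff.1 (st (i + 1)).2.1).1 hl i,
      fun hd hs => ?_⟩
    obtain ⟨n, hn⟩ := exists_nat_gt (∑' i, (w i).2)
    have h3 : elapsed w (st n).1.2 ≤ ∑' i, (w i).2 := hs.sum_le_tsum _ fun _ _ => zero_le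
    rw [elapsed_congr (hw n)] at h3
    exact absurd ((helapsed hd n).trans h3) (not_le.2 hn)
  have hwX : ∀ j, ¬ X (conf c w (ρ w) j) := by
    intro j
    rw [hcaus w (st j).1.1 hwv (st j).2.1 j fun i hi => hw j i (hi.trans_le (hle j))]
    exact (st j).2.2 j (hle j)
  obtain ⟨hrun, hacc⟩ := h2 w hwv
  rw [hF] at hacc
  obtain ⟨i, hi⟩ := hacc
  rw [hrun.src_eq] at hi
  exact hwX i (T.rank_mono tc F _ (Nat.zero_le N) ⟨0, hi⟩)

end Reach

end TimedAut

namespace TimedAut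

section Translation

variable {Q A C : Type*}

/-! ### Timed words and delay words -/

/-- Replace time stamps by delays. -/
noncomputable def toDelays (w : TimedSeq A) : DelayWord A := fun i => ((w i).1, delay w i)

/-- Replace delays by time stamps. -/
def toStamps (u : DelayWord A) : TimedSeq A := fun i => ((u i).1, elapsed u (i + 1))

theorem monotone_toStamps (u : DelayWord A) : Monotone fun i => (toStamps u i).2 :=
  fun _ _ h => elapsed_mono u (Nat.succ_le_succ h)

theorem toDelays_toStamps (u : DelayWord A) : toDelays (toStamps u) = u := by
  funext i
  refine Prod.ext rfl ?_
  cases i with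
  | zero => simp [toDelays, toStamps, delay, elapsed]
  | succ i =>
    change elapsed u (i + 1 + 1) - elapsed u (i + 1) = _
    rw [elapsed_succ u (i + 1), add_tsub_cancel_left]

theorem elapsed_toDelays {w : TimedSeq A} (hw : Monotone fun i => (w i).2) (i : ℕ) :
    elapsed (toDelays w) (i + 1) = (w i).2 := by
  induction i with
  | zero => simp [elapsed, toDelays, delay]
  | succ i ih =>
    rw [elapsed_succ, ih]
    exact add_tsub_cancel_of_le (hw i.le_succ)

/-- Zero delays are forbidden before the first letter. -/
def TimeConvention.Initial (tc : TimeConvention) : Prop := tc.progression = .strong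

theorem isTimedWord_iff {tc : TimeConvention} {w : TimedSeq A} :
    IsTimedWord tc w ↔ (Monotone fun i => (w i).2) ∧ Valid tc tc.Initial (toDelays w) := by
  refine and_congr_right fun hw => ?_
  unfold Valid
  rw [← and_assoc]
  refine and_congr ?_ (imp_congr_right fun _ => ?_)
  · obtain ⟨p, d⟩ := tc
    cases p with
    | weak => simp [Progression.Holds, TimeConvention.Initial, TimeConvention.Later]
    | distinct => simp [Progression.Holds, TimeConvention.Initial, TimeConvention.Later, toDelays]
    | strong =>
      simp only [Progression.Holds, TimeConvention.Initial, TimeConvention.Later, toDelays]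
      constructor
      · exact fun h => ⟨fun _ => h 0, fun _ i => h (i + 1)⟩
      · rintro ⟨h0, h1⟩ i
        cases i with
        | zero => exact h0 trivial
        | succ i => exact h1 (by simp) i
  · rw [NNReal.not_summable_iff_tendsto_nat_atTop]
    change _ ↔ Filter.Tendsto (elapsed (toDelays w)) _ _
    have h : (fun i => elapsed (toDelays w) (i + 1)) = fun i => (w i).2 :=
      funext (elapsed_toDelays hw)
    rw [← Filter.tendsto_add_atTop_iff_nat (f := elapsed (toDelays w)) 1, h]

theorem TA.isRun_iff {T : TA Q A C} {c : Config Q C} {w : TimedSeq A}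
    {ρ : ℕ → Transition Q A C} : T.IsRun c w ρ ↔ T.Run c (toDelays w) ρ := by
  constructor
  · rintro ⟨κ, κ', h0, h⟩
    have hκ : ∀ i, conf c (toDelays w) ρ i = κ i := by
      intro i
      induction i with
      | zero => exact h0.symm
      | succ i ih =>
        obtain ⟨h1, ⟨-, -, -, h2⟩, -⟩ := h i
        rw [conf, ih, h2, h1]
        rfl
    intro i
    obtain ⟨h1, ⟨h2, h3, h4, -⟩, h5⟩ := h i
    unfold TA.StepAt
    rw [hκ]
    rw [h1] at h3 h4
    exact ⟨h2, h3, h5, h4⟩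
  · intro h
    refine ⟨conf c (toDelays w) ρ, fun i => ((conf c (toDelays w) ρ i).1,
      (conf c (toDelays w) ρ i).2.elapse (delay w i)), rfl, fun i => ⟨rfl, ?_, ?_⟩⟩
    · exact ⟨(h i).1, (h i).2.1, (h i).2.2.2, rfl⟩
    · exact (h i).2.2.1

theorem TA.mem_lang_iff {T : TA Q A C} {tc : TimeConvention} {w : TimedSeq A} :
    w ∈ T.lang tc ↔
      (Monotone fun i => (w i).2) ∧ toDelays w ∈ T.Acc tc tc.Initial T.initConfig := by
  change IsTimedWord tc w ∧ (∃ ρ, T.IsRun T.initConfig w ρ ∧ ρ ∈ T.acc) ↔ _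
  rw [isTimedWord_iff, and_assoc]
  simp only [TA.isRun_iff]
  rfl

theorem Strategy.history_congr (r : Strategy Q A C) {w w' : TimedSeq A} {i : ℕ}
    (h : ∀ j < i, toDelays w j = toDelays w' j) : r.history w i = r.history w' i := by
  induction i with
  | zero => rfl
  | succ i ih =>
    have h1 := congrArg Prod.fst (h i i.lt_succ_self)
    have h2 := congrArg Prod.snd (h i i.lt_succ_self)
    simp only [toDelays] at h1 h2
    rw [Strategy.history, Strategy.history, ih fun j hj => h j (by omega), h1, h2]

theorem Strategy.run_congr (r : Strategy Q A C) {w w' : TimedSeq A} {i : ℕ}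
    (h : ∀ j ≤ i, toDelays w j = toDelays w' j) : r.run w i = r.run w' i := by
  have h1 := congrArg Prod.fst (h i le_rfl)
  have h2 := congrArg Prod.snd (h i le_rfl)
  simp only [toDelays] at h1 h2
  rw [Strategy.run, Strategy.run, r.history_congr fun j hj => h j hj.le, h1, h2]

/-- A resolver wins the language from the initial configuration. -/
theorem TA.HistoryDeterministic.win {T : TA Q A C} {tc : TimeConvention}
    (hT : T.HistoryDeterministic tc) :
    T.Win T.initConfig (T.Acc tc tc.Initial T.initConfig) := by
  obtain ⟨r, -, hr⟩ := hT
  refine ⟨fun u => r.run (toStamps u), fun u _ v _ i huv => ?_, fun u hu => ?_⟩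
  · exact r.run_congr (by simpa only [toDelays_toStamps] using huv)
  · have hmem : toStamps u ∈ T.lang tc := by
      rw [TA.mem_lang_iff, toDelays_toStamps]
      exact ⟨monotone_toStamps u, hu⟩
    obtain ⟨h1, h2⟩ := hr _ hmem
    rw [TA.isRun_iff, toDelays_toStamps] at h1
    exact ⟨h1, h2⟩

/-! ### Pruning -/

/-- A region invariant selection of transitions that accepts the language can be enforced by
strengthening guards. -/
theorem TA.exists_pruning [Finite C] (T : TA Q A C) (tc : TimeConvention) {K : ℕ}
    (hK : T.BoundedBy K) (P : Q → Valuation C → A → Transition Q A C → Prop)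
    (hinv : ∀ s ν μ a τ, Agree K ν μ → P s ν a τ → P s μ a τ)
    (hex : ∀ s ν a, ∃ τ, T.Enabled s ν a τ ∧ P s ν a τ)
    (hsrc : ∀ ρ σ : ℕ → Transition Q A C, (∀ i, (ρ i).src = (σ i).src) → ρ ∈ T.acc → σ ∈ T.acc)
    (hacc : ∀ u ∈ T.Acc tc tc.Initial T.initConfig, ∀ ρ, T.Run T.initConfig u ρ →
      (∀ i, P (conf T.initConfig u ρ i).1 ((conf T.initConfig u ρ i).2.elapse (u i).2) (u i).1
        (ρ i)) → ρ ∈ T.acc) :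
    ∃ T' : TA Q A C, T'.Deterministic ∧ T'.lang tc = T.lang tc ∧ T'.IsGuardRestriction T := by
  let good : Q → Valuation C → A → Set (Transition Q A C) := fun s ν a =>
    {τ | T.Enabled s ν a τ ∧ P s ν a τ}
  have hne : ∀ s ν a, (good s ν a).Nonempty := hex
  let choice : {S : Set (Transition Q A C) // S.Nonempty} → Transition Q A C := fun S => S.2.some
  let pick : Q → Valuation C → A → Transition Q A C := fun s ν a => choice ⟨good s ν a, hne s ν a⟩
  have hpick : ∀ s ν a, T.Enabled s ν a (pick s ν a) ∧ P s ν a (pick s ν a) := fun s ν a =>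
    (hne s ν a).some_mem
  have hpick_inv : ∀ s ν μ a, Agree K ν μ → pick s ν a = pick s μ a := by
    intro s ν μ a h
    have : good s ν a = good s μ a := by
      ext τ
      exact and_congr (hK.enabled_iff h) ⟨hinv s ν μ a τ h, hinv s μ ν a τ h.symm⟩
    exact congrArg choice (Subtype.ext this)
  choose z hz using fun τ : Transition Q A C => exists_guard_of_invariant K
    (fun ν => pick τ.src ν τ.letter = τ) fun ν μ h hν => by
      rw [← hpick_inv _ ν μ _ h]
      exact hν
  let restrict : Transition Q A C → Transition Q A C := fun τ =>
    { τ with guard := τ.guard.and (z τ) }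
  let T' : TA Q A C :=
    { init := T.init
      trans := restrict '' T.trans
      finite_trans := T.finite_trans.image _
      complete := by
        intro s ν a
        obtain ⟨⟨h1, h2, h3, h4⟩, -⟩ := hpick s ν a
        exact ⟨restrict (pick s ν a), ⟨_, h1, rfl⟩, h2, h3, h4, by rw [hz, h2, h3]⟩
      acc := T.acc }
  have hrun : ∀ c u ρ, T'.Run c u ρ → ∃ σ, T.Run c u σ ∧ (∀ i, (σ i).src = (ρ i).src) ∧
      ∀ i, P (conf c u σ i).1 ((conf c u σ i).2.elapse (u i).2) (u i).1 (σ i) := by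
    intro c u ρ hρ
    choose σ hσ hσρ using fun i => (hρ i).1
    obtain rfl : (fun i => restrict (σ i)) = ρ := funext hσρ
    have hconf : ∀ i, conf c u (fun i => restrict (σ i)) i = conf c u σ i := by
      intro i
      induction i with
      | zero => rfl
      | succ i ih =>
        rw [conf, conf, ih]
        rfl
    have hσpick : ∀ i, T.Enabled (conf c u σ i).1 ((conf c u σ i).2.elapse (u i).2) (u i).1 (σ i) ∧
        pick (conf c u σ i).1 ((conf c u σ i).2.elapse (u i).2) (u i).1 = σ i := by
      intro i
      obtain ⟨-, h1, h2, h3, h4⟩ := hρ i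
      rw [hconf] at h1 h3 h4
      change (σ i).src = _ at h1
      change (σ i).letter = _ at h2
      refine ⟨⟨hσ i, h1, h2, h3⟩, ?_⟩
      rw [hz, h1, h2] at h4
      exact h4
    refine ⟨σ, fun i => (hσpick i).1, fun _ => rfl, fun i => ?_⟩
    have := (hpick (conf c u σ i).1 ((conf c u σ i).2.elapse (u i).2) (u i).1).2
    rwa [(hσpick i).2] at this
  refine ⟨T', ?_, ?_, rfl, rfl, ?_⟩
  · rintro _ ⟨τ, -, rfl⟩ _ ⟨τ', -, rfl⟩ hs ha ν ⟨-, h⟩ ⟨-, h'⟩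
    change τ.src = τ'.src at hs
    change τ.letter = τ'.letter at ha
    rw [hz] at h h'
    rw [← h, ← h', hs, ha]
  · ext w
    rw [TA.mem_lang_iff, TA.mem_lang_iff]
    refine and_congr_right fun _ => ?_
    constructor
    · rintro ⟨hv, ρ, hρ, hρa⟩
      obtain ⟨σ, hσ, hs, -⟩ := hrun _ _ ρ hρ
      exact ⟨hv, σ, hσ, hsrc ρ σ (fun i => (hs i).symm) hρa⟩
    · intro hw
      obtain ⟨ρ, hρ⟩ := T'.exists_run T'.initConfig (toDelays w)
      obtain ⟨σ, hσ, hs, hP⟩ := hrun _ _ ρ hρ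
      exact ⟨hw.1, ρ, hρ, hsrc σ ρ hs (hacc _ hw σ hσ hP)⟩
  · rintro _ ⟨τ, hτ, rfl⟩
    exact ⟨τ, hτ, z τ, rfl⟩

end Translation

/-! ### Determinization -/

section Determinization

variable {Q A C : Type*}

/-- After a step that wins the residual language, the accepted words are the residual ones. -/
theorem TA.Win.acc_fire_eq {T : TA Q A C} {tc : TimeConvention} {s : Q} {ν : Valuation C} {a : A}
    {τ : Transition Q A C} (he : T.Enabled s ν a τ)
    (hw : T.Win (τ.fire ν) (T.Residual tc s ν a)) :
    T.Acc tc tc.Later (τ.fire ν) = T.Residual tc s ν a := by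
  apply Set.Subset.antisymm
  · exact fun u hu => ⟨τ, he, hu⟩
  · rintro u hu
    obtain ⟨ρ, -, h⟩ := hw
    obtain ⟨_, _, hv, _⟩ := id hu
    exact ⟨hv, ρ u, h u hu⟩

theorem TA.exists_deterministic_of_safety [Finite C] {T : TA Q A C} {tc : TimeConvention}
    (hacc : T.IsSafety) (hT : T.HistoryDeterministic tc) :
    ∃ T' : TA Q A C, T'.Deterministic ∧ T'.lang tc = T.lang tc ∧ T'.IsGuardRestriction T := by
  obtain ⟨F, hF⟩ := hacc
  obtain ⟨K, hK⟩ := T.exists_boundedBy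
  have hneutral : ∀ s ∈ F, T.Neutral s := by
    intro s hs ρ hρ
    rw [hF]
    constructor
    · exact fun h i => h (i + 1)
    · intro h i
      cases i with
      | zero => rw [hρ]; exact hs
      | succ i => exact h i
  have hmem : ∀ q c u, u ∈ T.Acc tc q c → c.1 ∈ F := by
    rintro q c u ⟨-, ρ, hρ, ha⟩
    rw [hF] at ha
    have := ha 0
    rwa [hρ.src_eq] at this
  refine T.exists_pruning tc hK (fun s ν a τ =>
    (∃ τ', T.Enabled s ν a τ' ∧ T.Win (τ'.fire ν) (T.Residual tc s ν a)) →
      T.Win (τ.fire ν) (T.Residual tc s ν a)) ?_ ?_ ?_ ?_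
  · rintro s ν μ a τ h hP ⟨τ', he, hw⟩
    exact (hP ⟨τ', (hK.enabled_iff h).2 he, hw.residual_of_agree hK h.symm⟩).residual_of_agree hK h
  · intro s ν a
    by_cases h : ∃ τ', T.Enabled s ν a τ' ∧ T.Win (τ'.fire ν) (T.Residual tc s ν a)
    · obtain ⟨τ, he, hw⟩ := h
      exact ⟨τ, he, fun _ => hw⟩
    · obtain ⟨τ, h1, h2, h3, h4⟩ := T.complete s ν a
      exact ⟨τ, ⟨h1, h2, h3, h4⟩, fun h' => absurd h' h⟩
  · intro ρ σ h hρ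
    rw [hF] at hρ ⊢
    exact fun i => h i ▸ hρ i
  · intro u hu ρ hρ hP
    rw [hF]
    have key : ∀ i, ∃ q, T.Win (conf T.initConfig u ρ i) (T.Acc tc q (conf T.initConfig u ρ i)) ∧
        (fun j => u (j + i)) ∈ T.Acc tc q (conf T.initConfig u ρ i) := by
      intro i
      induction i with
      | zero => exact ⟨_, hT.win, hu⟩
      | succ i ih =>
        obtain ⟨q, hw, hm⟩ := ih
        have hs := hneutral _ (hmem _ _ _ hm)
        have hex := hw.exists_residual hs hm
        simp only [zero_add] at hex
        have hw' := hP i hex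
        have he := TA.Win.acc_fire_eq (hρ i) hw'
        have hm' := (hs.mem_acc_iff.1 hm).2
        simp only [zero_add] at hm'
        rw [← he] at hw' hm'
        have htail : (fun j => u (j + (i + 1))) = seqTail fun j => u (j + i) :=
          funext fun j => congrArg u (by omega)
        exact ⟨tc.Later, hw', htail ▸ hm'⟩
    intro i
    obtain ⟨q, -, hm⟩ := key i
    rw [hρ.src_eq]
    exact hmem _ _ _ hm

/-- All words that agree with `u` on the first `k` letters are accepted from `c`. -/
def TA.AcceptsPrefix (T : TA Q A C) (tc : TimeConvention) (q : Prop) (c : Config Q C)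
    (u : DelayWord A) (k : ℕ) : Prop :=
  ∀ v : DelayWord A, Valid tc q v → (∀ j < k, v j = u j) → v ∈ T.Acc tc q c

theorem TA.AcceptsPrefix.mono {T : TA Q A C} {tc : TimeConvention} {q : Prop} {c : Config Q C}
    {u : DelayWord A} {k l : ℕ} (hkl : k ≤ l) (h : T.AcceptsPrefix tc q c u k) :
    T.AcceptsPrefix tc q c u l :=
  fun v hv hvu => h v hv fun j hj => hvu j (hj.trans_le hkl)

/-- A run that visits `F` continues to an accepting run on every continuation of the word. -/
theorem TA.Run.acceptsPrefix {T : TA Q A C} {F : Set Q} (hF : T.acc = reachAcc A C F)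
    {tc : TimeConvention} {q : Prop} {c : Config Q C} {u : DelayWord A}
    {ρ : ℕ → Transition Q A C} (hρ : T.Run c u ρ) {k : ℕ} (hk : (ρ k).src ∈ F) :
    T.AcceptsPrefix tc q c u k := by
  intro v hv hvu
  refine ⟨hv, ?_⟩
  clear hv
  rw [hF]
  induction k generalizing c u v ρ with
  | zero =>
    obtain ⟨σ, hσ⟩ := T.exists_run c v
    refine ⟨σ, hσ, 0, ?_⟩
    rw [hσ.src_eq]
    rwa [hρ.src_eq] at hk
  | succ k ih =>
    have h := TA.run_iff_seqTail.1 hρ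
    obtain ⟨σ, hσ, i, hi⟩ := ih h.2 hk (v := seqTail v) fun j hj => hvu (j + 1) (by omega)
    have h0 : v 0 = u 0 := hvu 0 (by omega)
    refine ⟨seqCons (ρ 0) σ, TA.run_iff_seqTail.2 ?_, i + 1, hi⟩
    rw [h0]
    exact ⟨h.1, hσ⟩

/-- Transitions that are quickest towards `F` and, as long as it is not certain that `F` can be
reached, win the residual language if possible. -/
def TA.ReachOptimal (T : TA Q A C) (tc : TimeConvention) (F : Set Q) (s : Q) (ν : Valuation C)
    (a : A) (τ : Transition Q A C) : Prop :=
  T.Quickest tc F s ν a τ ∧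
    ((∃ τ', T.Enabled s ν a τ' ∧ T.Win (τ'.fire ν) (T.Residual tc s ν a)) →
      (∃ τ' n, T.Enabled s ν a τ' ∧ T.Rank tc F n (τ'.fire ν)) ∨
        T.Win (τ.fire ν) (T.Residual tc s ν a))

theorem TA.ReachOptimal.of_agree [Finite C] {T : TA Q A C} {tc : TimeConvention} {F : Set Q}
    {K : ℕ} (hK : T.BoundedBy K) {ν μ : Valuation C} (h : Agree K ν μ) {s : Q} {a : A}
    {τ : Transition Q A C} (hr : T.ReachOptimal tc F s ν a τ) :
    T.ReachOptimal tc F s μ a τ := by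
  refine ⟨hr.1.of_agree hK h, ?_⟩
  rintro ⟨τ', he, hw⟩
  rcases hr.2 ⟨τ', (hK.enabled_iff h).2 he, hw.residual_of_agree hK h.symm⟩ with
    ⟨τ'', n, he, hn⟩ | hw
  · left
    obtain ⟨φ, hφ⟩ := h.exists_sim
    obtain ⟨θ, hn⟩ := hn
    exact ⟨τ'', n, (hK.enabled_iff h).1 he, φ.nn θ,
      TA.Phases.of_sim hK (hφ.reset τ''.resets) hn⟩
  · exact .inr (hw.residual_of_agree hK h)

theorem TA.exists_reachOptimal (T : TA Q A C) (tc : TimeConvention) (F : Set Q) (s : Q)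
    (ν : Valuation C) (a : A) : ∃ τ, T.Enabled s ν a τ ∧ T.ReachOptimal tc F s ν a τ := by
  by_cases h : ∃ τ' n, T.Enabled s ν a τ' ∧ T.Rank tc F n (τ'.fire ν)
  · obtain ⟨τ, he, hq⟩ := T.exists_quickest tc F s ν a
    exact ⟨τ, he, hq, fun _ => .inl h⟩
  · have hq : ∀ τ, T.Quickest tc F s ν a τ := fun τ τ' he n θ hp =>
      (h ⟨τ', n, he, θ, hp⟩).elim
    by_cases h' : ∃ τ', T.Enabled s ν a τ' ∧ T.Win (τ'.fire ν) (T.Residual tc s ν a)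
    · obtain ⟨τ, he, hw⟩ := h'
      exact ⟨τ, he, hq τ, fun _ => .inr hw⟩
    · obtain ⟨τ, h1, h2, h3, h4⟩ := T.complete s ν a
      exact ⟨τ, ⟨h1, h2, h3, h4⟩, hq τ, fun h'' => absurd h'' h'⟩

/-- Runs along optimal transitions. -/
def TA.OptimalRun (T : TA Q A C) (tc : TimeConvention) (F : Set Q) (c : Config Q C)
    (u : DelayWord A) (ρ : ℕ → Transition Q A C) : Prop :=
  T.Run c u ρ ∧ ∀ i, T.ReachOptimal tc F (conf c u ρ i).1
    ((conf c u ρ i).2.elapse (u i).2) (u i).1 (ρ i)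

theorem TA.OptimalRun.seqTail {T : TA Q A C} {tc : TimeConvention} {F : Set Q} {c : Config Q C}
    {u : DelayWord A} {ρ : ℕ → Transition Q A C} (h : T.OptimalRun tc F c u ρ) :
    T.OptimalRun tc F ((ρ 0).fire (c.2.elapse (u 0).2)) (seqTail u) (seqTail ρ) := by
  refine ⟨(TA.run_iff_seqTail.1 h.1).2, fun i => ?_⟩
  have := h.2 (i + 1)
  rw [conf_succ'] at this
  exact this

/-- One step of an optimal run. -/
theorem TA.OptimalRun.step {T : TA Q A C} {tc : TimeConvention} {F : Set Q}
    (hF : T.acc = reachAcc A C F) {q : Prop} {c : Config Q C} {u : DelayWord A}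
    {ρ : ℕ → Transition Q A C} (h : T.OptimalRun tc F c u ρ) (hu : Valid tc q u)
    (hw : T.Win c (T.Acc tc q c)) {k : ℕ} (hk : T.AcceptsPrefix tc q c u (k + 1)) :
    (∃ i, (ρ i).src ∈ F) ∨
      (T.Win ((ρ 0).fire (c.2.elapse (u 0).2))
          (T.Acc tc tc.Later ((ρ 0).fire (c.2.elapse (u 0).2))) ∧
        T.AcceptsPrefix tc tc.Later ((ρ 0).fire (c.2.elapse (u 0).2)) (TimedAut.seqTail u) k) := by
  by_cases hc : c.1 ∈ F
  · exact .inl ⟨0, by rw [h.1.src_eq]; exact hc⟩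
  have hs : T.Neutral c.1 := by
    intro σ hσ
    rw [hF]
    constructor
    · rintro ⟨i, hi⟩
      cases i with
      | zero => exact absurd (hσ ▸ hi) hc
      | succ i => exact ⟨i, hi⟩
    · rintro ⟨i, hi⟩
      exact ⟨i + 1, hi⟩
  have hv := valid_iff_seqTail.1 hu
  have hua : u ∈ T.Acc tc q c := hk u hu fun _ _ => rfl
  rcases (h.2 0).2 (hw.exists_residual hs hua) with ⟨τ, n, he, θ, hn⟩ | hw'
  · left
    obtain ⟨i, hi⟩ := TA.Rank.exists_mem (i := 0) id hv.2 h.seqTail.1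
      (fun i => (h.seqTail.2 i).1) ⟨θ, (h.2 0).1 τ he n θ hn⟩
    exact ⟨i + 1, hi⟩
  · right
    have heq := TA.Win.acc_fire_eq (h.1 0) hw'
    refine ⟨by rw [← heq] at hw'; exact hw', fun v hvv hvu => ?_⟩
    have hm : seqCons (u 0) v ∈ T.Acc tc q c := by
      refine hk _ (valid_iff_seqTail.2 ⟨hv.1, hvv⟩) fun j hj => ?_
      cases j with
      | zero => rfl
      | succ j => exact hvu j (by omega)
    have := (hs.mem_acc_iff.1 hm).2
    exact (Set.ext_iff.1 heq v).2 this

/-- Optimal runs reach `F` on words that have an accepted prefix. -/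
theorem TA.OptimalRun.exists_mem [Finite Q] [Finite C] {T : TA Q A C} {tc : TimeConvention}
    {F : Set Q} (hF : T.acc = reachAcc A C F) {c : Config Q C} {u : DelayWord A}
    {ρ : ℕ → Transition Q A C} (h : T.OptimalRun tc F c u ρ) (hu : Valid tc tc.Later u)
    (hw : T.Win c (T.Acc tc tc.Later c)) {k : ℕ} (hk : T.AcceptsPrefix tc tc.Later c u k) :
    ∃ i, (ρ i).src ∈ F := by
  induction k generalizing c u ρ with
  | zero =>
    obtain ⟨n, hn⟩ := TA.Win.exists_rank hF
      (hw.mono fun v hv => hk v hv fun j hj => absurd hj (Nat.not_lt_zero j))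
    exact TA.Rank.exists_mem (i := 0) id hu h.1 (fun i => (h.2 i).1) hn
  | succ k ih =>
    rcases h.step hF hu hw hk with h' | ⟨hw', hk'⟩
    · exact h'
    · obtain ⟨i, hi⟩ := ih h.seqTail (valid_iff_seqTail.1 hu).2 hw' hk'
      exact ⟨i + 1, hi⟩

theorem TA.exists_deterministic_of_reachability [Finite Q] [Finite C] {T : TA Q A C}
    {tc : TimeConvention} (hacc : T.IsReachability) (hT : T.HistoryDeterministic tc) :
    ∃ T' : TA Q A C, T'.Deterministic ∧ T'.lang tc = T.lang tc ∧ T'.IsGuardRestriction T := by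
  obtain ⟨F, hF⟩ := hacc
  obtain ⟨K, hK⟩ := T.exists_boundedBy
  refine T.exists_pruning tc hK (T.ReachOptimal tc F)
    (fun s ν μ a τ h hr => hr.of_agree hK h) (T.exists_reachOptimal tc F) ?_ ?_
  · intro ρ σ h hρ
    rw [hF] at hρ ⊢
    obtain ⟨i, hi⟩ := hρ
    exact ⟨i, h i ▸ hi⟩
  · rintro u ⟨hu, σ, hσ, hσa⟩ ρ hρ hP
    rw [hF] at hσa ⊢
    obtain ⟨k, hk⟩ := hσa
    have hopt : T.OptimalRun tc F T.initConfig u ρ := ⟨hρ, hP⟩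
    rcases hopt.step hF hu hT.win ((hσ.acceptsPrefix hF hk).mono k.le_succ) with h | ⟨hw, hk'⟩
    · exact h
    · obtain ⟨i, hi⟩ := hopt.seqTail.exists_mem hF (valid_iff_seqTail.1 hu).2 hw hk'
      exact ⟨i + 1, hi⟩

end Determinization

end TimedAut

theorem mainTheorem3 {Q A C : Type*} [Finite Q] [Finite C]
    (tc : TimedAut.TimeConvention) (T : TimedAut.TA Q A C)
    (hacc : T.IsSafety ∨ T.IsReachability)
    (hT : T.HistoryDeterministic tc) :
    ∃ T' : TimedAut.TA Q A C,
      T'.Deterministic ∧ T'.lang tc = T.lang tc ∧ T'.IsGuardRestriction T := by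
  rcases hacc with h | h
  · exact TimedAut.TA.exists_deterministic_of_safety h hT
  · exact TimedAut.TA.exists_deterministic_of_reachability h hT
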